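/- Let $\mathbb{C}[T]=\mathbb{C}[z_1^{\pm1},z_2^{\pm1},z_3^{\pm1}]$ be the ring of complex Laurent polynomials (trigonometric polynomials via $z_j=e^{-i\omega_j}$), with the involution $*$ that conjugates coefficients and sends $z_j$ to $z_j^{-1}$. Let $M\in\mathbb{Z}^{3\times 3}$ with $\det M\neq 0$ (for instance a dilation matrix), let $G=2\pi M^{-T}\mathbb{Z}^3/2\pi\mathbb{Z}^3$, and for $p\in\mathbb{C}[T]$, $\sigma\in G$ put $p^\sigma(e^{-i\omega})=p(e^{-i(\omega+\sigma)})$. Say that $p$ is a *sub-QMF symbol without UEP frame* (for $M$) if * $p(\mathbf 1)=1$, where $\mathbf 1=(1,1,1)$; * $p$ satisfies the sub-QMF condition $f:=1-\sum_{\sigma\in G}p^{\sigma*}p^\sigma\ge 0$ on $\mathbb{T}^3$; * neither $1-p^*p$ nor $f$ is a sum of hermitian squares, i.e. of the form $\sum_{j=1}^r h_j^*h_j$ with $h_j\in\mathbb{C}[T]$; * no finite family $q_1,\dots,q_N\in\mathbb{C}[T]$ satisfies the UEP identities $\delta_{\sigma,\tau}-p^{\sigma*}p^\tau=\sum_{j=1}^N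 q_j^{\sigma*}q_j^\tau$ for all $\sigma,\tau\in G$. Let $m=y_1^4y_2^2+y_1^2y_2^4+y_3^6-3y_1^2y_2^2y_3^2$ with $y_j=\sin\omega_j$ (the Motzkin polynomial in the coordinates $y_j$). Then: 1. For every $M\in\mathbb{Z}^{3\times3}$ with $\det M\ne0$ there exists a sub-QMF symbol $p\in\mathbb{C}[T]$ without UEP frame. 2. For every such $M$, every real $c$ with $0<c\le\frac13$, and every $a\in\mathbb{C}[T]$ with $a(\mathbf 1)=1$ and $1-\sum_{\sigma\in G}a^{\sigma*}a^\sigma\ge0$ on $\mathbb{T}^3$ such that all partial derivatives of orders $1,\dots,7$ of $\omega\mapsto (a^*a)(e^{-i\omega})$ vanish at $\omega=0$ (in particular if those of $\omega\mapsto a(e^{-i\omega})$ do), the polynomial $p=(1-c\cdot m)\,a$ is a sub-QMF symbol without UEP frame. 3. Call a real polynomial $u$ of degree less than $16$ a *Daubechies symbol with $8$ vanishing moments* if $(1+z)^8$ divides $u$, $u(1)=1$, and $|u(z)|^2+|u(-z)|^2=1$ for $|z|=1$. Such $u$ exist, and for every such $u$ and every $0<c\le\frac13$, the polynomial $p=(1-c\cdot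 m)\,a$ with $a(z)=u(z_1)u(z_2)u(z_3)$ is a sub-QMF symbol without UEP frame for $M=2I$. -/

import Mathlib

noncomputable section

namespace TightFrame

open scoped ComplexOrder

/-- The ring `ℂ[T] = ℂ[z₁^{±1}, …, z_d^{±1}]` of complex Laurent polynomials;
`AddMonoidAlgebra.single α c` is the term `c z^α`. -/
abbrev Laurent (d : ℕ) : Type := AddMonoidAlgebra ℂ (Fin d → ℤ)

/-- The real points `𝕋^d` of the torus; its neutral element is `1`. -/
abbrev Torus (d : ℕ) : Type := Fin d → Circle

/-- The point `e^{-iω} = (e^{-iω₁}, …, e^{-iω_d})`. -/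
def expTorus {d : ℕ} (ω : Fin d → ℝ) : Torus d := fun j => Circle.exp (-(ω j))

/-- The character `α ↦ ζ^α` of `ℤ^d` attached to a point `ζ` of the torus. -/
def monomialChar {d : ℕ} (ζ : Torus d) : Multiplicative (Fin d → ℤ) →* ℂ where
  toFun α := ((∏ j, ζ j ^ (α.toAdd j) : Circle) : ℂ)
  map_one' := by simp
  map_mul' α β := by
    rw [← Circle.coe_mul, ← Finset.prod_mul_distrib]
    simp [zpow_add]

/-- Evaluation `p ↦ p(ζ)` at a point of the torus. -/
def eval {d : ℕ} (ζ : Torus d) : Laurent d →ₐ[ℂ] ℂ :=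
  AddMonoidAlgebra.lift ℂ ℂ (Fin d → ℤ) (monomialChar ζ)

/-- The trigonometric polynomial `ω ↦ p(e^{-iω})`. -/
def trigFun {d : ℕ} (p : Laurent d) (ω : Fin d → ℝ) : ℂ := eval (expTorus ω) p

/-- The involution `*`: conjugation on coefficients and `z_j ↦ z_j⁻¹`. -/
def invol {d : ℕ} : Laurent d →+* Laurent d :=
  (AddMonoidAlgebra.mapDomainRingHom ℂ (-(AddMonoidHom.id (Fin d → ℤ)))).comp
    (AddMonoidAlgebra.mapRingHom (Fin d → ℤ) (starRingEnd ℂ))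

/-- The monomial `z^α`, as a multiplicative map in `α`, multiplied by `ζ^α`. -/
def translateMonomial {d : ℕ} (ζ : Torus d) :
    Multiplicative (Fin d → ℤ) →* Laurent d where
  toFun α := AddMonoidAlgebra.single α.toAdd (monomialChar ζ α)
  map_one' := by simp [AddMonoidAlgebra.one_def]
  map_mul' α β := by simp [AddMonoidAlgebra.single_mul_single]

/-- The translate `p^σ`, with `ζ = e^{-iσ}`, i.e. `p^σ(z) = p(z ζ)`. -/
def translate {d : ℕ} (ζ : Torus d) : Laurent d →ₐ[ℂ] Laurent d :=
  AddMonoidAlgebra.lift ℂ (Laurent d) (Fin d → ℤ) (translateMonomial ζ)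

theorem eval_single {d : ℕ} (ζ : Torus d) (α : Fin d → ℤ) (c : ℂ) :
    eval ζ (AddMonoidAlgebra.single α c) = c * ((∏ j, ζ j ^ α j : Circle) : ℂ) := by
  simp [eval, AddMonoidAlgebra.lift_single, monomialChar]

theorem invol_single {d : ℕ} (α : Fin d → ℤ) (c : ℂ) :
    invol (AddMonoidAlgebra.single α c) =
      AddMonoidAlgebra.single (-α) (starRingEnd ℂ c) := by
  simp [invol]

theorem eval_translate {d : ℕ} (ζ z : Torus d) (p : Laurent d) :
    eval z (translate ζ p) = eval (z * ζ) p := by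
  induction p using AddMonoidAlgebra.induction_linear with
  | zero => simp
  | add f g hf hg => simp [hf, hg]
  | single α c =>
    simp [translate, translateMonomial, eval_single, AddMonoidAlgebra.lift_single, monomialChar,
      mul_zpow, Finset.prod_mul_distrib]
    ring

theorem eval_invol {d : ℕ} (ζ : Torus d) (p : Laurent d) :
    eval ζ (invol p) = starRingEnd ℂ (eval ζ p) := by
  induction p using AddMonoidAlgebra.induction_linear with
  | zero => simp
  | add f g hf hg => simp [hf, hg]
  | single α c =>
    rw [invol_single, eval_single, eval_single, map_mul, ← Circle.coe_inv_eq_conj]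
    simp

/-- The finite group `G = 2π M^{-T} ℤ^d / 2π ℤ^d`, viewed via `σ ↦ e^{-iσ}` as a subgroup of the
torus `𝕋^d`. -/
def dilationGroup {d : ℕ} (M : Matrix (Fin d) (Fin d) ℤ) : Subgroup (Torus d) where
  carrier := {ζ | ∃ k : Fin d → ℤ,
    ζ = expTorus ((2 * Real.pi) •
      ((M.map (Int.cast : ℤ → ℝ)).transpose⁻¹.mulVec fun j => (k j : ℝ)))}
  one_mem' := ⟨0, by
    funext j
    have : (fun j : Fin d => (((0 : Fin d → ℤ) j : ℤ) : ℝ)) = 0 := by ext; simp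
    rw [this]
    simp [expTorus]⟩
  mul_mem' := by
    rintro _ _ ⟨k, rfl⟩ ⟨l, rfl⟩
    refine ⟨k + l, ?_⟩
    have : (fun j : Fin d => (((k + l) j : ℤ) : ℝ)) =
        (fun j => (k j : ℝ)) + fun j => (l j : ℝ) := by ext; simp
    rw [this, Matrix.mulVec_add]
    funext j
    simp only [expTorus, Pi.mul_apply, Pi.smul_apply, Pi.add_apply, smul_eq_mul, ← Circle.exp_add]
    congr 1
    ring
  inv_mem' := by
    rintro _ ⟨k, rfl⟩
    refine ⟨-k, ?_⟩
    have : (fun j : Fin d => (((-k) j : ℤ) : ℝ)) = -(fun j => (k j : ℝ)) := by ext; simp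
    rw [this, Matrix.mulVec_neg]
    funext j
    simp [expTorus, Circle.exp_neg]

theorem pow_det_eq_one {d : ℕ} (M : Matrix (Fin d) (Fin d) ℤ) (hM : M.det ≠ 0)
    (ζ : Torus d) (hζ : ζ ∈ dilationGroup M) (j : Fin d) : ζ j ^ M.det = 1 := by
  obtain ⟨k, rfl⟩ := hζ
  have hdet : (M.map (Int.cast : ℤ → ℝ)).det = (M.det : ℝ) := by
    simpa using (Int.cast_det (R := ℝ) M).symm
  have hd : (M.det : ℝ) ≠ 0 := by exact_mod_cast hM
  have hadj : (M.map (Int.cast : ℤ → ℝ)).adjugate = M.adjugate.map (Int.cast : ℤ → ℝ) := by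
    simpa using ((Int.castRingHom ℝ).map_adjugate M).symm
  set v : ℤ := M.adjugate.transpose.mulVec k j with hv
  have key : ((M.map (Int.cast : ℤ → ℝ)).transpose⁻¹.mulVec fun j => (k j : ℝ)) j
      = (M.det : ℝ)⁻¹ * (v : ℝ) := by
    rw [← Matrix.transpose_nonsing_inv, Matrix.inv_def, hdet, hadj]
    simp [hv, Matrix.mulVec, dotProduct, Finset.mul_sum, mul_assoc]
  rw [expTorus, Pi.smul_apply, key, ← Circle.exp_zsmul, Circle.exp_eq_one]
  refine ⟨-v, ?_⟩
  simp
  field_simp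

instance dilationGroup_finite {d : ℕ} (M : Matrix (Fin d) (Fin d) ℤ) :
    Finite (dilationGroup M) := by
  by_cases hM : M.det = 0
  · have h0 : (M.map (Int.cast : ℤ → ℝ)).transpose⁻¹ = 0 := by
      apply Matrix.nonsing_inv_apply_not_isUnit
      have : (M.map (Int.cast : ℤ → ℝ)).det = (M.det : ℝ) := by
        simpa using (Int.cast_det (R := ℝ) M).symm
      rw [Matrix.det_transpose, this, hM]
      simp
    have : (dilationGroup M : Set (Torus d)) ⊆ {1} := by
      rintro _ ⟨k, rfl⟩
      rw [h0]
      funext j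
      simp [expTorus]
    exact (Set.finite_singleton _).subset this
  · have hfin : {z : Circle | z ^ M.det.natAbs = 1}.Finite := by
      have h1 : {z : ℂ | z ^ M.det.natAbs = 1}.Finite := by
        have hpos : 0 < M.det.natAbs := Int.natAbs_pos.mpr hM
        refine (Polynomial.nthRootsFinset M.det.natAbs (1 : ℂ)).finite_toSet.subset ?_
        intro z hz
        simpa [Polynomial.mem_nthRootsFinset hpos] using hz
      refine Set.Finite.of_finite_image (f := fun z : Circle => (z : ℂ)) (h1.subset ?_)
        (Subtype.val_injective.injOn)
      rintro _ ⟨z, hz, rfl⟩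
      have hz' : z ^ M.det.natAbs = 1 := hz
      have := congrArg (fun w : Circle => (w : ℂ)) hz'
      simpa using this
    refine (Set.Finite.pi (t := fun _ : Fin d => {z : Circle | z ^ M.det.natAbs = 1})
      fun _ => hfin).subset ?_
    intro ζ hζ j _
    exact pow_natAbs_eq_one.mpr (pow_det_eq_one M hM ζ hζ j)

/-- `f = 1 - ∑_{σ ∈ G} p^{σ*} p^σ`. -/
def qmfDefect {d : ℕ} (M : Matrix (Fin d) (Fin d) ℤ) (p : Laurent d) : Laurent d :=
  1 - ∑ᶠ σ : dilationGroup M, invol (translate (σ : Torus d) p) * translate (σ : Torus d) p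

/-- The sub-QMF condition `1 - ∑_{σ ∈ G} p^{σ*} p^σ ≥ 0` on `𝕋^d`. -/
def SubQMF {d : ℕ} (M : Matrix (Fin d) (Fin d) ℤ) (p : Laurent d) : Prop :=
  ∀ z : Torus d, 0 ≤ eval z (qmfDefect M p)

/-- `f` is a (finite) sum of hermitian squares. -/
def IsSumHermitianSquares {d : ℕ} (f : Laurent d) : Prop :=
  ∃ (r : ℕ) (h : Fin r → Laurent d), f = ∑ j, invol (h j) * h j

open scoped Classical in
/-- The identities of the Unitary Extension Principle,
`δ_{σ,τ} - p^{σ*} p^τ = ∑_j q_j^{σ*} q_j^τ` for all `σ, τ ∈ G`. -/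
def SatisfiesUEP {d : ℕ} (M : Matrix (Fin d) (Fin d) ℤ) (p : Laurent d)
    {N : ℕ} (q : Fin N → Laurent d) : Prop :=
  ∀ σ ∈ dilationGroup M, ∀ τ ∈ dilationGroup M,
    (if σ = τ then (1 : Laurent d) else 0) - invol (translate σ p) * translate τ p =
      ∑ j, invol (translate σ (q j)) * translate τ (q j)

/-- `p` is a trigonometric polynomial with `p(1) = 1` and the sub-QMF condition for which
`1 - p* p` and `1 - ∑_σ p^{σ*} p^σ` are not sums of hermitian squares, and for which the UEP
identities have no solution. -/
structure IsSubQMFWithoutUEP {d : ℕ} (M : Matrix (Fin d) (Fin d) ℤ) (p : Laurent d) : Prop where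
  eval_one : eval 1 p = 1
  subQMF : SubQMF M p
  not_sos : ¬ IsSumHermitianSquares (1 - invol p * p)
  not_sos_defect : ¬ IsSumHermitianSquares (qmfDefect M p)
  not_uep : ¬ ∃ (N : ℕ) (q : Fin N → Laurent d), SatisfiesUEP M p q

/-- The variable `z_j`. -/
def zvar {d : ℕ} (j : Fin d) : Laurent d := AddMonoidAlgebra.single (Pi.single j 1) 1

/-- The function `y_j = sin ω_j = (z_j⁻¹ - z_j) / (2i)`, where `z_j = e^{-iω_j}`. -/
def sinCoord {d : ℕ} (j : Fin d) : Laurent d :=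
  AddMonoidAlgebra.single (-Pi.single j 1) (1 / (2 * Complex.I)) -
    AddMonoidAlgebra.single (Pi.single j 1) (1 / (2 * Complex.I))

theorem trigFun_sinCoord {d : ℕ} (j : Fin d) (ω : Fin d → ℝ) :
    trigFun (sinCoord j) ω = (Real.sin (ω j) : ℂ) := by
  have h : ∀ n : ℤ, (∏ i, expTorus ω i ^ ((Pi.single j n : Fin d → ℤ) i)) = expTorus ω j ^ n := by
    intro n
    rw [Finset.prod_eq_single j] <;> simp +contextual
  have h' := h (-1)
  rw [Pi.single_neg] at h'
  rw [trigFun, sinCoord, map_sub, eval_single, eval_single, h, h']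
  simp only [expTorus, zpow_neg, zpow_one, Circle.coe_inv, Circle.coe_exp, ← Complex.exp_neg,
    Complex.ofReal_sin, Complex.sin]
  push_cast
  field_simp
  rw [Complex.I_sq]
  ring_nf

/-- The Motzkin polynomial in the local coordinates `y_j = sin ω_j`. -/
def motzkin : Laurent 3 :=
  sinCoord 0 ^ 4 * sinCoord 1 ^ 2 + sinCoord 0 ^ 2 * sinCoord 1 ^ 4 + sinCoord 2 ^ 6 -
    3 * sinCoord 0 ^ 2 * sinCoord 1 ^ 2 * sinCoord 2 ^ 2

/-- The trigonometric polynomial `(1 - c·m) a`. -/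
def motzkinSymbol (c : ℝ) (a : Laurent 3) : Laurent 3 :=
  (1 - AddMonoidAlgebra.single 0 (c : ℂ) * motzkin) * a

/-- Univariate Daubechies scaling symbols with `N` vanishing moments, normalised by `u(1) = 1`: real
polynomials of degree less than `2N` which are divisible by `(1 + z)^N` and satisfy
`|u(z)|² + |u(-z)|² = 1` on the unit circle. -/
structure IsDaubechiesSymbol (N : ℕ) (u : Polynomial ℝ) : Prop where
  natDegree_lt : u.natDegree < 2 * N
  dvd : (1 + Polynomial.X) ^ N ∣ u
  eval_one : u.eval 1 = 1
  qmf : ∀ z : Circle,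
    ‖Polynomial.aeval (z : ℂ) u‖ ^ 2 + ‖Polynomial.aeval (-(z : ℂ)) u‖ ^ 2 = 1

/-- The tensor product `u(z₁) ⋯ u(z_d)`. -/
def tensorSymbol (d : ℕ) (u : Polynomial ℝ) : Laurent d :=
  ∏ j : Fin d, Polynomial.aeval (zvar j : Laurent d) u

end TightFrame

end

/-!
A sum of hermitian squares `∑ hⱼ* hⱼ` that vanishes to order six at `1` has as its term of degree
six in `ω` a sum of squared moduli of complex cubic forms, namely of the third order parts of the
`hⱼ`. The Motzkin form is not such a sum (`motzkinForm_ne_sum_cubicForm`), so that no Laurent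
polynomial with a positive multiple of the Motzkin form as its lowest order term is a sum of
hermitian squares (`not_isSumHermitianSquares_of_tendsto`).

Let `p = (1 - c·m) a`, where `a` is a sub-QMF symbol such that `1 - |a|²` vanishes at `1` to
order more than six. On the torus `0 ≤ c·m ≤ 2`, hence `|p| ≤ |a|` and `p` is a sub-QMF symbol.
Both `1 - |p|²` and the defect of `p` have the lowest order term `2c·m`: the translates `p^σ`
with `σ ≠ 1` contribute at most `1 - |a|²` to the defect. So neither is a sum of hermitian
squares, whereas the UEP identity for `σ = τ = 1` would write `1 - |p|²` as one
(`isSubQMFWithoutUEP_motzkinSymbol`).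

It remains to supply symbols `a`. They are tensor products, for which the sub-QMF condition
reduces to one variable (`isSubQMFWithoutUEP_of_tensor`). For an arbitrary matrix with
`N = |det M|`, the squared moduli of the normalised Dirichlet kernel and its translates by the `N`-th
roots of unity form a partition of unity (`sum_dirichletSq_mul_pow`), and a step polynomial flat
at `0` and `1` turns it into a family with the required flatness and with sum at most one
(`sum_stepPoly_le_one`). Univariate Daubechies symbols are obtained from the polynomial
`∑_{k < 8} (7 + k choose k) y^k` by a Fejér–Riesz factorization with real coefficients
(`exists_norm_sq_eq_abs_eval`); they satisfy `1 - |u(z)|² = |u(-z)|²`, which vanishes to order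
sixteen at `z = 1`.
-/

noncomputable section

namespace TightFrame

open Filter Asymptotics Topology
open scoped ComplexOrder

/-! ### Squared moduli on the torus -/

theorem eval_invol_mul_self {d : ℕ} (z : Torus d) (p : Laurent d) :
    eval z (invol p * p) = ((‖eval z p‖ ^ 2 : ℝ) : ℂ) := by
  rw [map_mul, eval_invol, ← Complex.normSq_eq_conj_mul_self, Complex.normSq_eq_norm_sq]

theorem expTorus_zero {d : ℕ} : expTorus (0 : Fin d → ℝ) = 1 := by
  funext j
  simp [expTorus]

theorem translate_one {d : ℕ} (p : Laurent d) : translate 1 p = p := by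
  induction p using AddMonoidAlgebra.induction_linear with
  | zero => simp
  | add f g hf hg => simp [hf, hg]
  | single α c =>
    simp [translate, translateMonomial, AddMonoidAlgebra.lift_single, monomialChar]

theorem trigFun_single {d : ℕ} (α : Fin d → ℤ) (c : ℂ) (ω : Fin d → ℝ) :
    trigFun (AddMonoidAlgebra.single α c) ω =
      c * Complex.exp (-Complex.I * ((∑ j, (α j : ℝ) * ω j : ℝ) : ℂ)) := by
  have h : (∏ j, expTorus ω j ^ α j : Circle) = Circle.exp (-(∑ j, (α j : ℝ) * ω j)) := by
    have hj : ∀ j, expTorus ω j ^ α j = Circle.exp (-((α j : ℝ) * ω j)) := fun j => by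
      rw [expTorus, ← Circle.exp_zsmul]
      congr 1
      simp
    simp only [hj]
    rw [← Finset.sum_neg_distrib]
    exact (map_sum Circle.expHom (fun j => -((α j : ℝ) * ω j)) Finset.univ).symm
  rw [trigFun, eval_single, h, Circle.coe_exp]
  congr 2
  push_cast
  ring

/-! ### Third order expansions along lines -/

/-- The cubic form `∑ C i j k xᵢ xⱼ xₖ`. -/
def cubicForm {d : ℕ} (C : Fin d → Fin d → Fin d → ℂ) (x : Fin d → ℝ) : ℂ :=
  ∑ i, ∑ j, ∑ k, C i j k * (x i : ℂ) * (x j : ℂ) * (x k : ℂ)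

/-- A trigonometric polynomial has a third order Taylor expansion along every line through the
origin, and its third order term is a cubic form in the direction. -/
theorem exists_line_expansion {d : ℕ} (h : Laurent d) :
    ∃ (H₀ H₁ H₂ : (Fin d → ℝ) → ℂ) (C : Fin d → Fin d → Fin d → ℂ), ∀ x,
      (fun t : ℝ => trigFun h (t • x) -
        (H₀ x + t * H₁ x + t ^ 2 * H₂ x + t ^ 3 * cubicForm C x)) =O[𝓝 0]
          fun t : ℝ => t ^ 4 := by
  induction h using AddMonoidAlgebra.induction_linear with
  | zero =>
    refine ⟨0, 0, 0, 0, fun x => ?_⟩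
    simpa [trigFun, cubicForm] using isBigO_zero _ _
  | add f g hf hg =>
    obtain ⟨F₀, F₁, F₂, C, hf⟩ := hf
    obtain ⟨G₀, G₁, G₂, D, hg⟩ := hg
    refine ⟨F₀ + G₀, F₁ + G₁, F₂ + G₂, C + D, fun x => ((hf x).add (hg x)).congr_left fun t => ?_⟩
    have : cubicForm (C + D) x = cubicForm C x + cubicForm D x := by
      simp only [cubicForm, Pi.add_apply, add_mul, Finset.sum_add_distrib]
    simp only [this, trigFun, map_add, Pi.add_apply]
    ring
  | single α c =>
    set s : (Fin d → ℝ) → ℝ := fun x => ∑ j, (α j : ℝ) * x j with hs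
    refine ⟨fun _ => c, fun x => c * (-Complex.I * s x), fun x => c * ((-Complex.I * s x) ^ 2 / 2),
      fun i j k => c * (Complex.I / 6) * α i * α j * α k, fun x => ?_⟩
    have hcub : cubicForm (fun i j k => c * (Complex.I / 6) * α i * α j * α k) x =
        c * (Complex.I / 6) * (s x : ℂ) ^ 3 := by
      have : (s x : ℂ) ^ 3 = ∑ i, ∑ j, ∑ k,
          ((α i : ℂ) * x i) * ((α j : ℂ) * x j) * ((α k : ℂ) * x k) := by
        simp only [← Finset.mul_sum, ← Finset.sum_mul, hs]
        push_cast
        ring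
      rw [this]
      simp only [cubicForm, Finset.mul_sum]
      refine Finset.sum_congr rfl fun i _ => Finset.sum_congr rfl fun j _ =>
        Finset.sum_congr rfl fun k _ => ?_
      ring
    rw [hcub]
    have hsm : ∀ t : ℝ, (∑ j, (α j : ℝ) * (t • x) j) = t * s x := by
      intro t
      simp only [hs, Finset.mul_sum, Pi.smul_apply, smul_eq_mul]
      exact Finset.sum_congr rfl fun j _ => by ring
    have hev : ∀ᶠ t : ℝ in 𝓝 0, ‖-Complex.I * ((t * s x : ℝ) : ℂ)‖ ≤ 1 := by
      have : Tendsto (fun t : ℝ => ‖-Complex.I * ((t * s x : ℝ) : ℂ)‖) (𝓝 0) (𝓝 0) := by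
        have hc : Continuous fun t : ℝ => ‖-Complex.I * ((t * s x : ℝ) : ℂ)‖ := by fun_prop
        simpa using hc.tendsto 0
      exact (this.eventually (gt_mem_nhds zero_lt_one)).mono fun t ht => ht.le
    refine IsBigO.of_bound (‖c‖ * |s x| ^ 4) (hev.mono fun t ht => ?_)
    have hb := Complex.exp_bound ht (n := 4) (by norm_num)
    rw [trigFun_single, hsm]
    have e : c * Complex.exp (-Complex.I * ((t * s x : ℝ) : ℂ)) -
        (c + t * (c * (-Complex.I * s x)) + t ^ 2 * (c * ((-Complex.I * s x) ^ 2 / 2)) +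
          t ^ 3 * (c * (Complex.I / 6) * (s x : ℂ) ^ 3)) =
        c * (Complex.exp (-Complex.I * ((t * s x : ℝ) : ℂ)) -
          ∑ m ∈ Finset.range 4, (-Complex.I * ((t * s x : ℝ) : ℂ)) ^ m / (m.factorial : ℂ)) := by
      have hI : Complex.I ^ 3 = -Complex.I := Complex.I_pow_three
      simp only [Finset.sum_range_succ, Finset.sum_range_zero, Nat.factorial]
      push_cast
      linear_combination (-c * (t * s x) ^ 3 / 6) * hI
    rw [e, norm_mul, mul_assoc]
    refine mul_le_mul_of_nonneg_left (hb.trans ?_) (norm_nonneg _)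
    have : ‖-Complex.I * ((t * s x : ℝ) : ℂ)‖ = |t| * |s x| := by
      simp
    rw [this]
    have h0 : 0 ≤ (|t| * |s x|) ^ 4 := by positivity
    have : ‖t ^ 4‖ = |t| ^ 4 := by simp
    rw [this]
    norm_num [Nat.factorial]
    nlinarith [h0]

/-- One step of comparing coefficients: a continuous function of the form `a + t r(t)` which is
`O(t^{n+1})` has `a = 0` and `r = O(t^n)`. -/
theorem eq_zero_of_isBigO {n : ℕ} {a : ℂ} {r : ℝ → ℂ} (hr : Continuous r)
    (h : (fun t : ℝ => a + t * r t) =O[𝓝[≠] 0] fun t : ℝ => t ^ (n + 1)) :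
    a = 0 ∧ r =O[𝓝[≠] 0] fun t : ℝ => t ^ n := by
  have ha : a = 0 := by
    have h1 : Tendsto (fun t : ℝ => a + t * r t) (𝓝[≠] 0) (𝓝 0) := by
      refine h.trans_tendsto ?_
      have : Continuous fun t : ℝ => t ^ (n + 1) := by fun_prop
      simpa using (this.tendsto 0).mono_left nhdsWithin_le_nhds
    have h2 : Tendsto (fun t : ℝ => a + t * r t) (𝓝[≠] 0) (𝓝 a) := by
      have : Continuous fun t : ℝ => a + t * r t := by fun_prop
      simpa using (this.tendsto 0).mono_left nhdsWithin_le_nhds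
    exact tendsto_nhds_unique h2 h1
  refine ⟨ha, ?_⟩
  obtain ⟨K, hK⟩ := h.bound
  refine IsBigO.of_bound K ?_
  filter_upwards [hK, self_mem_nhdsWithin] with t ht ht0
  have ht0 : 0 < |t| := abs_pos.mpr ht0
  rw [ha, zero_add, norm_mul, Complex.norm_real, Real.norm_eq_abs, pow_succ, norm_mul,
    Real.norm_eq_abs t, ← mul_assoc, mul_comm |t|] at ht
  exact le_of_mul_le_mul_right ht ht0

/-- A function with a third order expansion which is `O(t³)` has no lower order terms, so that
dividing it by `t³` isolates the third order coefficient. -/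
theorem tendsto_div_cube {g : ℝ → ℂ} {h₀ h₁ h₂ h₃ : ℂ}
    (he : (fun t : ℝ => g t - (h₀ + t * h₁ + t ^ 2 * h₂ + t ^ 3 * h₃)) =O[𝓝 0]
      fun t : ℝ => t ^ 4)
    (hg : g =O[𝓝[≠] 0] fun t : ℝ => t ^ 3) :
    Tendsto (fun t : ℝ => g t / (t : ℂ) ^ 3) (𝓝[≠] 0) (𝓝 h₃) := by
  have he' := he.mono (nhdsWithin_le_nhds (s := {0}ᶜ))
  have h43 : (fun t : ℝ => t ^ 4) =O[𝓝[≠] 0] fun t : ℝ => t ^ 3 := by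
    refine IsBigO.of_bound 1 ?_
    filter_upwards [nhdsWithin_le_nhds (Metric.ball_mem_nhds (0 : ℝ) zero_lt_one)] with t ht
    have ht' : ‖t‖ < 1 := by simpa using ht
    rw [one_mul, norm_pow, norm_pow]
    exact pow_le_pow_of_le_one (norm_nonneg _) ht'.le (by norm_num)
  have hpoly : (fun t : ℝ => h₀ + t * (h₁ + t * (h₂ + t * h₃))) =O[𝓝[≠] 0]
      fun t : ℝ => t ^ (2 + 1) :=
    (hg.sub (he'.trans h43)).congr_left fun t => by ring
  obtain ⟨e0, hp1⟩ := eq_zero_of_isBigO (by fun_prop) hpoly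
  obtain ⟨e1, hp2⟩ := eq_zero_of_isBigO (n := 1) (by fun_prop) hp1
  obtain ⟨e2, -⟩ := eq_zero_of_isBigO (n := 0) (by fun_prop) hp2
  subst e0 e1 e2
  rw [tendsto_iff_norm_sub_tendsto_zero]
  obtain ⟨K, hK⟩ := he'.bound
  have hlim : Tendsto (fun t : ℝ => K * |t|) (𝓝[≠] 0) (𝓝 0) := by
    have : Continuous fun t : ℝ => K * |t| := by fun_prop
    simpa using (this.tendsto 0).mono_left nhdsWithin_le_nhds
  refine squeeze_zero' (Eventually.of_forall fun _ => norm_nonneg _) ?_ hlim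
  filter_upwards [hK, self_mem_nhdsWithin] with t ht ht0
  have ht0' : (t : ℂ) ≠ 0 := by simpa using ht0
  have ht1 : 0 < |t| ^ 3 := by
    have : 0 < |t| := abs_pos.mpr ht0
    positivity
  have : g t / (t : ℂ) ^ 3 - h₃ = (g t - (0 + t * 0 + t ^ 2 * 0 + t ^ 3 * h₃)) / (t : ℂ) ^ 3 := by
    field_simp
    ring
  rw [this, norm_div, norm_pow, Complex.norm_real, Real.norm_eq_abs, div_le_iff₀ ht1]
  refine ht.trans (le_of_eq ?_)
  rw [norm_pow, Real.norm_eq_abs]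
  ring

/-! ### The Motzkin form -/

/-- The Motzkin form, whose composition with the sine is `motzkin`. -/
def motzkinForm (x : Fin 3 → ℝ) : ℝ :=
  x 0 ^ 4 * x 1 ^ 2 + x 0 ^ 2 * x 1 ^ 4 + x 2 ^ 6 - 3 * x 0 ^ 2 * x 1 ^ 2 * x 2 ^ 2

theorem motzkinForm_vec (a b c : ℝ) :
    motzkinForm ![a, b, c] = a ^ 4 * b ^ 2 + a ^ 2 * b ^ 4 + c ^ 6 - 3 * a ^ 2 * b ^ 2 * c ^ 2 :=
  rfl

theorem nonpos_of_forall_sq_mul_le {A K : ℝ} (h : ∀ s : ℝ, s ^ 2 * A ≤ K) : A ≤ 0 := by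
  by_contra! hA
  have h1 := h (|K| / A + 1)
  have hK : 0 ≤ |K| / A := by positivity
  have h2 : (|K| / A + 1) * A = |K| + A := by field_simp
  nlinarith [le_abs_self K, abs_nonneg K]

/-- A multiple of the Motzkin form by a positive constant is not a sum of squared moduli of complex
cubic forms: all of them would vanish at the zeros `(±1, ±1, 1)`, and boundedness on the lines
`(s, 0, 1)` and `(0, s, 1)` removes the terms `x₀² x₂` and `x₁² x₂`, so that the sum over these
zeros gives the vanishing at `(0, 0, 1)`. -/
theorem motzkinForm_ne_sum_cubicForm {κ : ℝ} (hκ : 0 < κ) {r : ℕ}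
    (C : Fin r → Fin 3 → Fin 3 → Fin 3 → ℂ) :
    ¬ ∀ x, ∑ l, ‖cubicForm (C l) x‖ ^ 2 = κ * motzkinForm x := by
  intro h
  have hle : ∀ l x, ‖cubicForm (C l) x‖ ^ 2 ≤ κ * motzkinForm x := fun l x => by
    rw [← h x]
    exact Finset.single_le_sum (f := fun l => ‖cubicForm (C l) x‖ ^ 2)
      (fun _ _ => by positivity) (Finset.mem_univ l)
  have hzero : ∀ l x, motzkinForm x = 0 → cubicForm (C l) x = 0 := fun l x hx => by
    have := hle l x
    rw [hx, mul_zero] at this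
    simpa using le_antisymm this (by positivity)
  have hbd : ∀ l x, motzkinForm x = 1 → ‖cubicForm (C l) x‖ ≤ κ + 1 := fun l x hx => by
    have := hle l x
    rw [hx, mul_one] at this
    nlinarith [norm_nonneg (cubicForm (C l) x)]
  have key : ∀ l, cubicForm (C l) ![0, 0, 1] = 0 := by
    intro l
    set A : ℂ := C l 0 0 2 + C l 0 2 0 + C l 2 0 0 with hA
    set B : ℂ := C l 1 1 2 + C l 1 2 1 + C l 2 1 1 with hB
    have vanish : ∀ (D : ℂ) (f : ℝ → Fin 3 → ℝ), (∀ s, motzkinForm (f s) = 1) →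
        (∀ s : ℝ, 2 * s ^ 2 * D = cubicForm (C l) (f s) + cubicForm (C l) (f (-s)) -
          2 * cubicForm (C l) (f 0)) → D = 0 := by
      intro D f hf hD
      have : ‖D‖ ≤ 0 := by
        refine nonpos_of_forall_sq_mul_le (K := 4 * (κ + 1)) fun s => ?_
        have h1 : ‖2 * (s : ℂ) ^ 2 * D‖ = 2 * (s ^ 2 * ‖D‖) := by
          simp [mul_assoc]
        have h2 : ‖2 * (s : ℂ) ^ 2 * D‖ ≤ 4 * (κ + 1) := by
          rw [hD s]
          refine (norm_sub_le _ _).trans ?_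
          rw [norm_mul]
          have := norm_add_le (cubicForm (C l) (f s)) (cubicForm (C l) (f (-s)))
          have h3 := hbd l _ (hf s)
          have h4 := hbd l _ (hf (-s))
          have h5 := hbd l _ (hf 0)
          have h6 : ‖(2 : ℂ)‖ = 2 := by simp
          rw [h6]
          linarith
        nlinarith [sq_nonneg s, norm_nonneg D, mul_nonneg (sq_nonneg s) (norm_nonneg D)]
      simpa using this
    have hA0 : A = 0 := by
      refine vanish A (fun s => ![s, 0, 1]) (fun s => by simp [motzkinForm_vec]) fun s => ?_
      simp [cubicForm, Fin.sum_univ_three, hA]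
      ring
    have hB0 : B = 0 := by
      refine vanish B (fun s => ![0, s, 1]) (fun s => by simp [motzkinForm_vec]) fun s => ?_
      simp [cubicForm, Fin.sum_univ_three, hB]
      ring
    have e1 := hzero l ![1, 1, 1] (by norm_num [motzkinForm_vec])
    have e2 := hzero l ![-1, 1, 1] (by norm_num [motzkinForm_vec])
    have e3 := hzero l ![1, -1, 1] (by norm_num [motzkinForm_vec])
    have e4 := hzero l ![-1, -1, 1] (by norm_num [motzkinForm_vec])
    have hsum : cubicForm (C l) ![1, 1, 1] + cubicForm (C l) ![-1, 1, 1] +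
        cubicForm (C l) ![1, -1, 1] + cubicForm (C l) ![-1, -1, 1] =
        4 * (A + B + cubicForm (C l) ![0, 0, 1]) := by
      simp [cubicForm, Fin.sum_univ_three, hA, hB]
      ring
    rw [e1, e2, e3, e4, hA0, hB0] at hsum
    simpa using hsum.symm
  have := h ![0, 0, 1]
  simp only [key, norm_zero] at this
  norm_num [motzkinForm_vec] at this
  exact hκ.ne this

/-- A Laurent polynomial whose lowest order term at `1` is a positive multiple of the Motzkin form
is not a sum of hermitian squares, since the cubic parts of the squares would add up to it. -/
theorem not_isSumHermitianSquares_of_tendsto {f : Laurent 3} {κ : ℝ} (hκ : 0 < κ)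
    (hf : ∀ x : Fin 3 → ℝ, Tendsto (fun t : ℝ => (trigFun f (t • x)).re / t ^ 6) (𝓝[≠] 0)
      (𝓝 (κ * motzkinForm x))) : ¬ IsSumHermitianSquares f := by
  rintro ⟨r, h, rfl⟩
  have hre : ∀ ω, (trigFun (∑ j, invol (h j) * h j) ω).re = ∑ j, ‖trigFun (h j) ω‖ ^ 2 := by
    intro ω
    simp only [trigFun, map_sum, eval_invol_mul_self, ← Complex.ofReal_sum, Complex.ofReal_re]
  simp only [hre] at hf
  choose H₀ H₁ H₂ C hC using fun j => exists_line_expansion (h j)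
  refine motzkinForm_ne_sum_cubicForm hκ C fun x => ?_
  refine tendsto_nhds_unique ?_ (hf x)
  have hO : ∀ j, (fun t : ℝ => trigFun (h j) (t • x)) =O[𝓝[≠] 0] fun t : ℝ => t ^ 3 := by
    intro j
    refine IsBigO.of_bound (κ * motzkinForm x + 1 + 1) ?_
    filter_upwards [(hf x).eventually (gt_mem_nhds (lt_add_one _)), self_mem_nhdsWithin]
      with t ht ht0
    have ht0 : t ≠ 0 := ht0
    have ht6 : 0 < t ^ 6 := by positivity
    rw [div_lt_iff₀ ht6] at ht
    have h1 : ‖trigFun (h j) (t • x)‖ ^ 2 ≤ ∑ j, ‖trigFun (h j) (t • x)‖ ^ 2 :=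
      Finset.single_le_sum (f := fun j => ‖trigFun (h j) (t • x)‖ ^ 2)
        (fun _ _ => by positivity) (Finset.mem_univ j)
    have h0 : 0 ≤ κ * motzkinForm x + 1 := by
      by_contra! hneg
      have : 0 ≤ ‖trigFun (h j) (t • x)‖ ^ 2 := by positivity
      nlinarith
    have h3 : ‖t ^ 3‖ ^ 2 = t ^ 6 := by
      rw [norm_pow, Real.norm_eq_abs, ← pow_mul, Even.pow_abs (by decide)]
    refine abs_le_of_sq_le_sq' ?_ (by positivity) |>.2
    rw [mul_pow, h3]
    nlinarith
  have hlim := tendsto_finsetSum (Finset.univ : Finset (Fin r)) fun j _ =>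
    ((tendsto_div_cube (hC j x) (hO j)).norm.pow 2)
  refine hlim.congr' ?_
  filter_upwards with t
  rw [Finset.sum_div]
  refine Finset.sum_congr rfl fun j _ => ?_
  rw [norm_div, div_pow, norm_pow, Complex.norm_real, Real.norm_eq_abs, ← pow_mul,
    Even.pow_abs (by decide)]

/-! ### The sub-QMF defect -/

theorem eval_qmfDefect {d : ℕ} (M : Matrix (Fin d) (Fin d) ℤ) [Fintype (dilationGroup M)]
    (p : Laurent d) (z : Torus d) :
    eval z (qmfDefect M p) =
      ((1 - ∑ σ : dilationGroup M, ‖eval (z * (σ : Torus d)) p‖ ^ 2 : ℝ) : ℂ) := by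
  rw [qmfDefect, finsum_eq_sum_of_fintype]
  simp only [map_sub, map_one, map_sum, eval_invol_mul_self, eval_translate]
  push_cast
  rfl

theorem subQMF_iff {d : ℕ} (M : Matrix (Fin d) (Fin d) ℤ) [Fintype (dilationGroup M)]
    (p : Laurent d) :
    SubQMF M p ↔ ∀ z : Torus d, ∑ σ : dilationGroup M, ‖eval (z * (σ : Torus d)) p‖ ^ 2 ≤ 1 := by
  simp only [SubQMF, eval_qmfDefect, Complex.zero_le_real, sub_nonneg]

/-- The UEP identity for `σ = τ = 1` writes `1 - p* p` as a sum of hermitian squares. -/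
theorem isSumHermitianSquares_of_satisfiesUEP {d : ℕ} {M : Matrix (Fin d) (Fin d) ℤ}
    {p : Laurent d} {N : ℕ} {q : Fin N → Laurent d} (h : SatisfiesUEP M p q) :
    IsSumHermitianSquares (1 - invol p * p) := by
  refine ⟨N, q, ?_⟩
  simpa [translate_one] using h 1 (one_mem _) 1 (one_mem _)

/-! ### The Motzkin symbol -/

theorem exists_eq_expTorus {d : ℕ} (z : Torus d) : ∃ ω : Fin d → ℝ, z = expTorus ω :=
  ⟨fun j => -(z j : ℂ).arg, funext fun j => by simp [expTorus, Circle.exp_arg]⟩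

theorem trigFun_motzkin (ω : Fin 3 → ℝ) :
    trigFun motzkin ω = (motzkinForm (fun j => Real.sin (ω j)) : ℂ) := by
  have h : ∀ j, eval (expTorus ω) (sinCoord j) = (Real.sin (ω j) : ℂ) :=
    fun j => trigFun_sinCoord j ω
  simp only [trigFun, motzkin, motzkinForm, map_sub, map_add, map_mul, map_pow, h, map_ofNat]
  push_cast
  ring

theorem trigFun_motzkinSymbol (c : ℝ) (a : Laurent 3) (ω : Fin 3 → ℝ) :
    trigFun (motzkinSymbol c a) ω =
      ((1 - c * motzkinForm (fun j => Real.sin (ω j)) : ℝ) : ℂ) * trigFun a ω := by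
  have h := trigFun_motzkin ω
  have h0 : eval (expTorus ω) (AddMonoidAlgebra.single 0 (c : ℂ)) = c := by
    simp [eval_single]
  rw [trigFun] at h ⊢
  rw [motzkinSymbol, map_mul, map_sub, map_mul, map_one, h, h0, trigFun]
  push_cast
  rfl

theorem motzkinForm_nonneg (x : Fin 3 → ℝ) : 0 ≤ motzkinForm x := by
  -- as a function of `x₂²`, the form is minimal at `u = |x₀ x₁|`
  have h : motzkinForm x = (|x 0| * |x 1|) ^ 2 * (|x 0| - |x 1|) ^ 2 +
      (x 2 ^ 2 - |x 0| * |x 1|) ^ 2 * (x 2 ^ 2 + 2 * (|x 0| * |x 1|)) := by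
    rw [motzkinForm, ← sq_abs (x 0), ← sq_abs (x 1), ← Even.pow_abs (by decide : Even 4) (x 0),
      ← Even.pow_abs (by decide : Even 4) (x 1)]
    ring
  rw [h]
  positivity

theorem motzkinForm_le_two {x : Fin 3 → ℝ} (hx : ∀ j, x j ^ 2 ≤ 1) : motzkinForm x ≤ 2 := by
  have key : ∀ a b c : ℝ, 0 ≤ a → a ≤ 1 → 0 ≤ b → b ≤ 1 → 0 ≤ c → c ≤ 1 →
      a ^ 2 * b + a * b ^ 2 + c ^ 3 - 3 * a * b * c ≤ 2 := by
    intro a b c ha ha1 hb hb1 hc hc1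
    have hab : 0 ≤ a * b := mul_nonneg ha hb
    have hab1 : a * b ≤ 1 := mul_le_one₀ ha1 hb hb1
    have h1 : a * b * (a + b) ≤ 2 := by nlinarith
    have h2 : a * b * (3 - a - b) ≥ 0 := mul_nonneg hab (by linarith)
    have h3 : c ^ 3 ≤ c := by nlinarith [mul_nonneg hc (sub_nonneg.2 hc1)]
    nlinarith [mul_nonneg (sub_nonneg.2 hc1) (sub_nonneg.2 h1), mul_nonneg hc h2]
  refine (le_of_eq ?_).trans (key (x 0 ^ 2) (x 1 ^ 2) (x 2 ^ 2) (sq_nonneg _) (hx 0) (sq_nonneg _)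
    (hx 1) (sq_nonneg _) (hx 2))
  rw [motzkinForm]
  ring

theorem norm_motzkinSymbol_le {c : ℝ} (hc0 : 0 ≤ c) (hc : c ≤ 1) (a : Laurent 3)
    (z : Torus 3) : ‖eval z (motzkinSymbol c a)‖ ≤ ‖eval z a‖ := by
  obtain ⟨ω, rfl⟩ := exists_eq_expTorus z
  have h := trigFun_motzkinSymbol c a ω
  rw [trigFun, trigFun] at h
  rw [h, norm_mul, Complex.norm_real]
  refine mul_le_of_le_one_left (norm_nonneg _) ?_
  have h0 := motzkinForm_nonneg fun j => Real.sin (ω j)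
  have h2 := motzkinForm_le_two (x := fun j => Real.sin (ω j)) fun j => Real.sin_sq_le_one _
  rw [Real.norm_eq_abs, abs_le]
  constructor <;> nlinarith

theorem motzkinForm_smul (t : ℝ) (x : Fin 3 → ℝ) :
    motzkinForm (fun j => t * x j) = t ^ 6 * motzkinForm x := by
  simp only [motzkinForm]
  ring

theorem tendsto_motzkinForm_sin_div (x : Fin 3 → ℝ) :
    Tendsto (fun t : ℝ => motzkinForm (fun j => Real.sin (t * x j)) / t ^ 6) (𝓝[≠] 0)
      (𝓝 (motzkinForm x)) := by
  have hs : ∀ j, Tendsto (fun t : ℝ => t⁻¹ * Real.sin (t * x j)) (𝓝[≠] 0) (𝓝 (x j)) := by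
    intro j
    have : HasDerivAt (fun t : ℝ => Real.sin (t * x j)) (x j) 0 := by
      simpa using ((hasDerivAt_id (0 : ℝ)).mul_const (x j)).sin
    simpa using hasDerivAt_iff_tendsto_slope_zero.1 this
  have hc : Continuous motzkinForm := by
    unfold motzkinForm
    fun_prop
  refine ((hc.tendsto x).comp (tendsto_pi_nhds.2 hs)).congr' ?_
  filter_upwards [self_mem_nhdsWithin] with t ht
  have ht : t ≠ 0 := ht
  rw [Function.comp_apply, motzkinForm_smul, inv_pow]
  field_simp

/-- If `a` is a sub-QMF symbol with `a(1) = 1` and `1 - |a|²` vanishes to order more than six at the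
origin along every line, then `1 - |p|²` and the defect of `p = (1 - c·m) a` both have the
lowest order term `2c` times the Motzkin form. -/
theorem isSubQMFWithoutUEP_motzkinSymbol {M : Matrix (Fin 3) (Fin 3) ℤ} {c : ℝ} {a : Laurent 3}
    (hc0 : 0 < c) (hc : c ≤ 1) (ha : eval 1 a = 1) (hsub : SubQMF M a)
    (hflat : ∀ x : Fin 3 → ℝ,
      (fun t : ℝ => 1 - ‖trigFun a (t • x)‖ ^ 2) =o[𝓝[≠] 0] fun t : ℝ => t ^ 6) :
    IsSubQMFWithoutUEP M (motzkinSymbol c a) := by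
  classical
  have := Fintype.ofFinite (dilationGroup M)
  rw [subQMF_iff] at hsub
  have hsq : ∀ z, ‖eval z (motzkinSymbol c a)‖ ^ 2 ≤ ‖eval z a‖ ^ 2 := fun z =>
    pow_le_pow_left₀ (norm_nonneg _) (norm_motzkinSymbol_le hc0.le hc a z) 2
  have hlim0 : ∀ x : Fin 3 → ℝ, Tendsto (fun t : ℝ => (1 - ‖trigFun a (t • x)‖ ^ 2) / t ^ 6)
      (𝓝[≠] 0) (𝓝 0) := fun x => (hflat x).tendsto_div_nhds_zero
  have hlim : ∀ x : Fin 3 → ℝ,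
      Tendsto (fun t : ℝ => (1 - ‖trigFun (motzkinSymbol c a) (t • x)‖ ^ 2) / t ^ 6)
        (𝓝[≠] 0) (𝓝 (2 * c * motzkinForm x)) := by
    intro x
    have hm := tendsto_motzkinForm_sin_div x
    have hm0 : Tendsto (fun t : ℝ => motzkinForm (fun j => Real.sin (t * x j))) (𝓝[≠] 0)
        (𝓝 0) := by
      have : Continuous fun t : ℝ => motzkinForm (fun j => Real.sin (t * x j)) := by
        unfold motzkinForm
        fun_prop
      have h0 := (this.tendsto 0).mono_left (nhdsWithin_le_nhds (s := {0}ᶜ))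
      simpa [motzkinForm] using h0
    have hone := (hm0.const_mul c).const_sub 1
    have := ((hlim0 x).mul (hone.pow 2)).add
      ((hm.const_mul (2 * c)).sub ((hm.mul hm0).const_mul (c ^ 2)))
    refine (this.congr fun t => ?_).trans (le_of_eq ?_)
    · rw [trigFun_motzkinSymbol, norm_mul, Complex.norm_real, mul_pow, Real.norm_eq_abs, sq_abs]
      simp only [Pi.smul_apply, smul_eq_mul]
      ring
    · congr 1
      ring
  have hsos : ¬ IsSumHermitianSquares
      (1 - invol (motzkinSymbol c a) * motzkinSymbol c a) := by
    refine not_isSumHermitianSquares_of_tendsto (κ := 2 * c) (by positivity) fun x =>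
      (hlim x).congr fun t => ?_
    congr 1
    rw [trigFun, trigFun, map_sub, eval_invol_mul_self, map_one, Complex.sub_re, Complex.ofReal_re,
      Complex.one_re]
  refine ⟨?_, ?_, hsos, ?_, fun ⟨N, q, hq⟩ => hsos (isSumHermitianSquares_of_satisfiesUEP hq)⟩
  · have h := trigFun_motzkinSymbol c a 0
    rw [trigFun, trigFun, expTorus_zero, ha] at h
    rw [h]
    simp [motzkinForm]
  · rw [subQMF_iff]
    exact fun z => (Finset.sum_le_sum fun σ _ => hsq _).trans (hsub z)
  · refine not_isSumHermitianSquares_of_tendsto (κ := 2 * c) (by positivity) fun x => ?_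
    -- the terms with `σ ≠ 1` are dominated by those of `a`, whose sum is at most `1 - |a|²`
    have hsplit : ∀ (p : Laurent 3) (z : Torus 3),
        ∑ σ : dilationGroup M, ‖eval (z * (σ : Torus 3)) p‖ ^ 2 = ‖eval z p‖ ^ 2 +
          ∑ σ ∈ Finset.univ.erase (1 : dilationGroup M), ‖eval (z * (σ : Torus 3)) p‖ ^ 2 := by
      intro p z
      rw [← Finset.add_sum_erase _ _ (Finset.mem_univ (1 : dilationGroup M))]
      simp
    set R : ℝ → ℝ := fun t => ∑ σ ∈ Finset.univ.erase (1 : dilationGroup M),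
      ‖eval (expTorus (t • x) * (σ : Torus 3)) (motzkinSymbol c a)‖ ^ 2 with hR
    have hRle : ∀ t, R t ≤ 1 - ‖trigFun a (t • x)‖ ^ 2 := by
      intro t
      have h1 := hsub (expTorus (t • x))
      rw [hsplit] at h1
      have h2 : R t ≤ _ := Finset.sum_le_sum fun σ _ => hsq _
      rw [trigFun]
      linarith
    have hR0 : Tendsto (fun t => R t / t ^ 6) (𝓝[≠] 0) (𝓝 0) := by
      refine squeeze_zero (fun t => ?_) (fun t => ?_) (hlim0 x)
      · have : 0 ≤ R t := Finset.sum_nonneg fun _ _ => by positivity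
        positivity
      · exact div_le_div_of_nonneg_right (hRle t) (by positivity)
    refine (((hlim x).sub hR0).congr fun t => ?_).trans (le_of_eq (by rw [sub_zero]))
    rw [trigFun, trigFun, eval_qmfDefect, Complex.ofReal_re, hsplit, ← sub_div, sub_sub]

/-! ### Flatness at the origin from vanishing derivatives -/

theorem contDiff_trigFun {d : ℕ} (p : Laurent d) {n : WithTop ℕ∞} :
    ContDiff ℝ n (trigFun p) := by
  induction p using AddMonoidAlgebra.induction_linear with
  | zero =>
    have : trigFun (0 : Laurent d) = fun _ => 0 := by
      funext ω
      simp [trigFun]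
    rw [this]
    exact contDiff_const
  | add f g hf hg =>
    have : trigFun (f + g) = fun ω => trigFun f ω + trigFun g ω := by
      funext ω
      simp [trigFun]
    rw [this]
    exact hf.add hg
  | single α c =>
    have : trigFun (AddMonoidAlgebra.single α c) = fun ω : Fin d → ℝ =>
        c * Complex.exp (-Complex.I * Complex.ofRealCLM (∑ j, (α j : ℝ) * ω j)) := by
      funext ω
      exact trigFun_single α c ω
    rw [this]
    fun_prop

/-- If the derivatives of orders `1, …, n` of a smooth function vanish at the origin, so do the
Taylor coefficients of these orders along every line. -/
theorem isLittleO_sub_of_iteratedFDeriv_eq_zero {E F : Type*} [NormedAddCommGroup E]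
    [NormedSpace ℝ E] [NormedAddCommGroup F] [NormedSpace ℝ F] {f : E → F} {n : ℕ}
    (hf : ContDiff ℝ n f) (h : ∀ k, 0 < k → k ≤ n → iteratedFDeriv ℝ k f 0 = 0) (x : E) :
    (fun t : ℝ => f (t • x) - f 0) =o[𝓝 0] fun t : ℝ => t ^ n := by
  set L : ℝ →L[ℝ] E := ContinuousLinearMap.toSpanSingleton ℝ x with hL
  have hT := taylor_isLittleO_univ (x₀ := 0) (hf.comp L.contDiff)
  simp only [sub_zero] at hT
  refine hT.congr_left fun t => ?_
  have hk : ∀ k ∈ Finset.range (n + 1), k ≠ 0 →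
      ((k.factorial : ℝ)⁻¹ * (t - 0) ^ k) • iteratedDerivWithin k (f ∘ L) Set.univ 0 = 0 := by
    intro k hk hk0
    have hkn : k ≤ n := Nat.lt_succ_iff.1 (Finset.mem_range.1 hk)
    have hL0 : L 0 = 0 := map_zero L
    rw [iteratedDerivWithin_univ, iteratedDeriv_eq_iteratedFDeriv,
      L.iteratedFDeriv_comp_right hf 0 (by exact_mod_cast hkn), hL0,
      h k (Nat.pos_of_ne_zero hk0) hkn]
    simp
  rw [taylor_within_apply, Finset.sum_eq_single 0 hk (by simp)]
  simp [hL]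

theorem isLittleO_one_sub_norm_sq {a : Laurent 3} (ha : eval 1 a = 1)
    (h : ∀ k : ℕ, 0 < k → k < 8 → iteratedFDeriv ℝ k (trigFun (invol a * a)) 0 = 0)
    (x : Fin 3 → ℝ) :
    (fun t : ℝ => 1 - ‖trigFun a (t • x)‖ ^ 2) =o[𝓝[≠] 0] fun t : ℝ => t ^ 6 := by
  have h1 := (isLittleO_sub_of_iteratedFDeriv_eq_zero (n := 6) (contDiff_trigFun _)
    (fun k hk hk' => h k hk (by omega)) x).mono (nhdsWithin_le_nhds (s := {0}ᶜ))
  refine (h1.norm_left.congr_left fun t => ?_).of_norm_left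
  rw [trigFun, trigFun, eval_invol_mul_self, eval_invol_mul_self, expTorus_zero, ha, norm_one,
    one_pow, ← Complex.ofReal_sub, Complex.norm_real, norm_sub_rev, trigFun]

/-! ### Tensor products -/

/-- The inequality `∑_{σ ∈ G} |a^σ|² ≤ 1` for a tensor product reduces to one variable, since `G` is
contained in a product `S × ⋯ × S`. -/
theorem subQMF_of_tensor {d : ℕ} {M : Matrix (Fin d) (Fin d) ℤ} {a : Laurent d} {b : Circle → ℝ}
    {S : Finset Circle} (hb : ∀ z, 0 ≤ b z) (hS : ∀ z, ∑ ζ ∈ S, b (z * ζ) ≤ 1)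
    (hG : ∀ σ ∈ dilationGroup M, ∀ j, σ j ∈ S) (ha : ∀ z, ‖eval z a‖ ^ 2 = ∏ j, b (z j)) :
    SubQMF M a := by
  classical
  have := Fintype.ofFinite (dilationGroup M)
  rw [subQMF_iff]
  intro z
  have h1 : ∑ σ : dilationGroup M, ‖eval (z * (σ : Torus d)) a‖ ^ 2 =
      ∑ ζ ∈ Finset.univ.image (Subtype.val : dilationGroup M → Torus d),
        ∏ j, b (z j * ζ j) := by
    rw [Finset.sum_image Subtype.val_injective.injOn]
    refine Finset.sum_congr rfl fun σ _ => ?_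
    rw [ha]
    rfl
  have h2 : ∑ ζ ∈ Finset.univ.image (Subtype.val : dilationGroup M → Torus d),
      ∏ j, b (z j * ζ j) ≤ ∑ ζ ∈ Fintype.piFinset fun _ : Fin d => S, ∏ j, b (z j * ζ j) := by
    refine Finset.sum_le_sum_of_subset_of_nonneg (fun ζ hζ => ?_) fun _ _ _ =>
      Finset.prod_nonneg fun _ _ => hb _
    obtain ⟨σ, -, rfl⟩ := Finset.mem_image.1 hζ
    exact Fintype.mem_piFinset.2 (hG _ σ.2)
  have h3 : ∑ ζ ∈ Fintype.piFinset fun _ : Fin d => S, ∏ j, b (z j * ζ j) =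
      ∏ j, ∑ ζ ∈ S, b (z j * ζ) :=
    (Finset.prod_univ_sum (fun _ => S) fun j ζ => b (z j * ζ)).symm
  rw [h1]
  refine h2.trans ?_
  rw [h3]
  exact Finset.prod_le_one (fun _ _ => Finset.sum_nonneg fun _ _ => hb _) fun j _ => hS _

theorem isLittleO_one_sub_norm_sq_of_tensor {a : Laurent 3} {b : Circle → ℝ} {K : ℝ}
    (hb : ∀ z, 0 ≤ b z) (hb1 : ∀ z, b z ≤ 1) (hK : ∀ z, 1 - b z ≤ K * ‖(z : ℂ) - 1‖ ^ 8)
    (ha : ∀ z, ‖eval z a‖ ^ 2 = ∏ j, b (z j)) (x : Fin 3 → ℝ) :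
    (fun t : ℝ => 1 - ‖trigFun a (t • x)‖ ^ 2) =o[𝓝[≠] 0] fun t : ℝ => t ^ 6 := by
  have hK0 : 0 ≤ K := by
    have h := hK (Circle.exp Real.pi)
    have h1 := hb1 (Circle.exp Real.pi)
    by_contra! hneg
    norm_num [Circle.coe_exp] at h
    nlinarith
  have hj : ∀ (t : ℝ) j, 1 - b (expTorus (t • x) j) ≤ K * |x j| ^ 8 * t ^ 8 := by
    intro t j
    refine (hK _).trans ?_
    have h1 : ‖((expTorus (t • x) j : Circle) : ℂ) - 1‖ ≤ |t| * |x j| := by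
      have := Real.norm_exp_I_mul_ofReal_sub_one_le (x := -(t * x j))
      rw [mul_comm, Real.norm_eq_abs, abs_neg, abs_mul] at this
      rw [expTorus, Circle.coe_exp]
      exact this
    calc K * ‖((expTorus (t • x) j : Circle) : ℂ) - 1‖ ^ 8 ≤ K * (|t| * |x j|) ^ 8 := by gcongr
      _ = K * |x j| ^ 8 * t ^ 8 := by
        rw [mul_pow, Even.pow_abs (by decide) t]
        ring
  have hO : (fun t : ℝ => 1 - ‖trigFun a (t • x)‖ ^ 2) =O[𝓝 0] fun t : ℝ => t ^ 8 := by
    refine IsBigO.of_bound (∑ j, K * |x j| ^ 8) (Eventually.of_forall fun t => ?_)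
    rw [trigFun, ha, Fin.prod_univ_three, Fin.sum_univ_three]
    have h0 := hj t 0
    have h1 := hj t 1
    have h2 := hj t 2
    set p := b (expTorus (t • x) 0)
    set q := b (expTorus (t • x) 1)
    set r := b (expTorus (t • x) 2)
    have hp : 0 ≤ p ∧ p ≤ 1 := ⟨hb _, hb1 _⟩
    have hq : 0 ≤ q ∧ q ≤ 1 := ⟨hb _, hb1 _⟩
    have hr : 0 ≤ r ∧ r ≤ 1 := ⟨hb _, hb1 _⟩
    have hpq : p * q ≤ 1 := mul_le_one₀ hp.2 hq.1 hq.2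
    have e1 : 1 - p * q ≤ (1 - p) + (1 - q) := by nlinarith
    have e2 : 1 - p * q * r ≤ (1 - p * q) + (1 - r) := by nlinarith
    have e3 : p * q * r ≤ 1 := mul_le_one₀ hpq hr.1 hr.2
    rw [Real.norm_of_nonneg (by linarith), Real.norm_of_nonneg (by positivity)]
    linarith
  exact (hO.trans_isLittleO (isLittleO_pow_pow (by norm_num))).mono nhdsWithin_le_nhds

theorem isSubQMFWithoutUEP_of_tensor {M : Matrix (Fin 3) (Fin 3) ℤ} {c : ℝ} {a : Laurent 3}
    {b : Circle → ℝ} {S : Finset Circle} {K : ℝ} (hc0 : 0 < c) (hc : c ≤ 1) (ha1 : eval 1 a = 1)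
    (hb : ∀ z, 0 ≤ b z) (hS1 : 1 ∈ S) (hS : ∀ z, ∑ ζ ∈ S, b (z * ζ) ≤ 1)
    (hK : ∀ z, 1 - b z ≤ K * ‖(z : ℂ) - 1‖ ^ 8)
    (hG : ∀ σ ∈ dilationGroup M, ∀ j, σ j ∈ S) (ha : ∀ z, ‖eval z a‖ ^ 2 = ∏ j, b (z j)) :
    IsSubQMFWithoutUEP M (motzkinSymbol c a) := by
  refine isSubQMFWithoutUEP_motzkinSymbol hc0 hc ha1 (subQMF_of_tensor hb hS hG ha)
    (isLittleO_one_sub_norm_sq_of_tensor hb (fun z => ?_) hK ha)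
  calc b z = b (z * 1) := by rw [mul_one]
    _ ≤ ∑ ζ ∈ S, b (z * ζ) := Finset.single_le_sum (f := fun ζ => b (z * ζ))
      (fun _ _ => hb _) hS1
    _ ≤ 1 := hS z

/-! ### A step polynomial compatible with partitions of unity -/

/-- The cubic factor `q` of the step polynomial `x⁴ q(x)`. -/
def stepCofactor (x : ℝ) : ℝ := 35 - 84 * x + 70 * x ^ 2 - 20 * x ^ 3

/-- The polynomial `x⁴ (35 - 84 x + 70 x² - 20 x³)`, the probability of more than three successes in
seven independent trials with success probability `x`. -/
def stepPoly (x : ℝ) : ℝ := x ^ 4 * stepCofactor x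

theorem stepPoly_one_sub (x : ℝ) : stepPoly (1 - x) = 1 - stepPoly x := by
  simp only [stepPoly, stepCofactor]
  ring

theorem stepCofactor_nonneg {x : ℝ} (hx : x ≤ 1) : 0 ≤ stepCofactor x := by
  have h : stepCofactor x = 20 * (1 - x) ^ 3 + 10 * (1 - x) ^ 2 + 4 * (1 - x) + 1 := by
    simp only [stepCofactor]
    ring
  have := sub_nonneg.2 hx
  rw [h]
  positivity

theorem stepPoly_nonneg {x : ℝ} (hx : x ≤ 1) : 0 ≤ stepPoly x :=
  mul_nonneg (by positivity) (stepCofactor_nonneg hx)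

theorem stepPoly_le_one {x : ℝ} (hx : 0 ≤ x) : stepPoly x ≤ 1 := by
  have := stepPoly_nonneg (x := 1 - x) (by linarith)
  rw [stepPoly_one_sub] at this
  linarith

theorem one_sub_stepPoly_le {x : ℝ} (hx0 : 0 ≤ x) (hx : x ≤ 1) :
    1 - stepPoly x ≤ 35 * (1 - x) ^ 4 := by
  rw [← stepPoly_one_sub, stepPoly, mul_comm]
  refine mul_le_mul_of_nonneg_right ?_ (by positivity)
  set y := 1 - x with hy
  have h0 : 0 ≤ y := by linarith
  have h1 : y ≤ 1 := by linarith
  rw [stepCofactor]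
  nlinarith [mul_nonneg h0 (sub_nonneg.2 h1), pow_nonneg h0 3]

theorem monotoneOn_stepPoly_div :
    MonotoneOn (fun x : ℝ => x ^ 3 * stepCofactor x) (Set.Icc 0 (1 / 2)) := by
  have hd : ∀ x : ℝ, HasDerivAt (fun x : ℝ => x ^ 3 * stepCofactor x)
      (x ^ 2 * (105 - 336 * x + 350 * x ^ 2 - 120 * x ^ 3)) x := by
    intro x
    have h1 := ((((hasDerivAt_pow 3 x).const_mul 35).sub ((hasDerivAt_pow 4 x).const_mul 84)).add
      ((hasDerivAt_pow 5 x).const_mul 70)).sub ((hasDerivAt_pow 6 x).const_mul 20)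
    refine (h1.congr_deriv ?_).congr_of_eventuallyEq (Eventually.of_forall fun y => ?_)
    · norm_num
      ring
    · simp only [stepCofactor, Pi.add_apply, Pi.sub_apply]
      ring
  refine monotoneOn_of_deriv_nonneg (convex_Icc _ _)
    (fun x _ => (hd x).continuousAt.continuousWithinAt)
    (fun x _ => (hd x).differentiableAt.differentiableWithinAt) fun x hx => ?_
  rw [interior_Icc] at hx
  rw [(hd x).deriv]
  refine mul_nonneg (by positivity) ?_
  have h1 : 0 ≤ 1 / 2 - x := by linarith [hx.2]
  have h2 : 105 - 336 * x + 350 * x ^ 2 - 120 * x ^ 3 =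
      19 / 2 + 76 * (1 / 2 - x) + 170 * (1 / 2 - x) ^ 2 + 120 * (1 / 2 - x) ^ 3 := by ring
  rw [h2]
  positivity

/-- The step polynomial is superadditive below `1/2` and satisfies `Φ(x) + Φ(1 - x) = 1`, hence it
maps partitions of unity to families with sum at most one. -/
theorem sum_stepPoly_le_one {ι : Type*} [DecidableEq ι] (s : Finset ι) {x : ι → ℝ}
    (hx : ∀ i, 0 ≤ x i) (hs : ∑ i ∈ s, x i ≤ 1) : ∑ i ∈ s, stepPoly (x i) ≤ 1 := by
  have hsub : ∀ {y r : ℝ}, 0 ≤ y → y ≤ r → r ≤ 1 / 2 →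
      stepPoly y ≤ y * (r ^ 3 * stepCofactor r) := by
    intro y r hy hyr hr
    have := monotoneOn_stepPoly_div ⟨hy, hyr.trans hr⟩ ⟨hy.trans hyr, hr⟩ hyr
    calc stepPoly y = y * (y ^ 3 * stepCofactor y) := by
          rw [stepPoly]
          ring
      _ ≤ _ := mul_le_mul_of_nonneg_left this hy
  by_cases h : ∀ i ∈ s, x i ≤ 1 / 2
  · refine (Finset.sum_le_sum fun i hi => ?_).trans hs
    refine (hsub (hx i) (h i hi) le_rfl).trans (le_of_eq ?_)
    norm_num [stepCofactor]
  · push Not at h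
    obtain ⟨i, hi, hxi⟩ := h
    rw [← Finset.add_sum_erase _ _ hi] at hs ⊢
    have hr0 : ∑ k ∈ s.erase i, x k ≤ 1 - x i := by linarith
    have hle : ∀ k ∈ s.erase i, x k ≤ 1 - x i := fun k hk =>
      (Finset.single_le_sum (fun j _ => hx j) hk).trans hr0
    have hpos : 0 ≤ 1 - x i := (Finset.sum_nonneg fun k _ => hx k).trans hr0
    have h1 : ∑ k ∈ s.erase i, stepPoly (x k) ≤
        (∑ k ∈ s.erase i, x k) * ((1 - x i) ^ 3 * stepCofactor (1 - x i)) := by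
      rw [Finset.sum_mul]
      exact Finset.sum_le_sum fun k hk => hsub (hx k) (hle k hk) (by linarith)
    have h2 : (∑ k ∈ s.erase i, x k) * ((1 - x i) ^ 3 * stepCofactor (1 - x i)) ≤
        (1 - x i) * ((1 - x i) ^ 3 * stepCofactor (1 - x i)) :=
      mul_le_mul_of_nonneg_right hr0
        (mul_nonneg (by positivity) (stepCofactor_nonneg (by linarith [hx i])))
    have h3 : (1 - x i) * ((1 - x i) ^ 3 * stepCofactor (1 - x i)) = 1 - stepPoly (x i) := by
      rw [← stepPoly_one_sub, stepPoly]
      ring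
    linarith

/-! ### The normalised Dirichlet kernel -/

/-- The function `|1 + z + ⋯ + z^{N-1}|² / N²`. -/
def dirichletSq (N : ℕ) (z : Circle) : ℝ := ‖∑ n ∈ Finset.range N, (z : ℂ) ^ n‖ ^ 2 / N ^ 2

theorem dirichletSq_nonneg (N : ℕ) (z : Circle) : 0 ≤ dirichletSq N z := by
  unfold dirichletSq
  positivity

/-- Parseval's identity for the discrete Fourier transform. -/
theorem sum_dirichletSq_mul_pow {N : ℕ} (hN : N ≠ 0) {ρ : Circle} (hρ : IsPrimitiveRoot ρ N)
    (z : Circle) : ∑ k ∈ Finset.range N, dirichletSq N (z * ρ ^ k) = 1 := by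
  have horth : ∀ n ∈ Finset.range N, ∀ m ∈ Finset.range N,
      ∑ k ∈ Finset.range N, (((ρ ^ n * (ρ ^ m)⁻¹ : Circle) : ℂ)) ^ k =
        if n = m then (N : ℂ) else 0 := by
    intro n hn m hm
    split_ifs with h
    · subst h
      simp
    · have hw : ((ρ ^ n * (ρ ^ m)⁻¹ : Circle) : ℂ) ≠ 1 := by
        intro h1
        have h2 : ρ ^ n * (ρ ^ m)⁻¹ = 1 := Circle.ext (by simpa using h1)
        exact h (hρ.pow_inj (Finset.mem_range.1 hn) (Finset.mem_range.1 hm) (mul_inv_eq_one.1 h2))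
      have hwN : ((ρ ^ n * (ρ ^ m)⁻¹ : Circle) : ℂ) ^ N = 1 := by
        rw [← Circle.coe_pow, mul_pow, inv_pow, ← pow_mul, ← pow_mul, mul_comm n, mul_comm m,
          pow_mul, pow_mul, hρ.pow_eq_one]
        simp
      rw [geom_sum_eq hw, hwN, sub_self, zero_div]
  have hsq : ∀ k, ((‖∑ n ∈ Finset.range N, ((z * ρ ^ k : Circle) : ℂ) ^ n‖ ^ 2 : ℝ) : ℂ) =
      ∑ n ∈ Finset.range N, ∑ m ∈ Finset.range N,
        ((z ^ n * (z ^ m)⁻¹ : Circle) : ℂ) * (((ρ ^ n * (ρ ^ m)⁻¹ : Circle) : ℂ)) ^ k := by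
    intro k
    rw [← Complex.normSq_eq_norm_sq, ← Complex.mul_conj, map_sum, Finset.sum_mul_sum]
    refine Finset.sum_congr rfl fun n _ => Finset.sum_congr rfl fun m _ => ?_
    rw [map_pow, ← Circle.coe_inv_eq_conj]
    simp only [← Circle.coe_pow, ← Circle.coe_mul]
    congr 1
    rw [mul_pow, inv_pow, mul_pow, mul_pow, inv_pow, ← pow_mul, ← pow_mul, ← pow_mul, ← pow_mul,
      mul_comm k n, mul_comm k m, mul_inv]
    exact mul_mul_mul_comm _ _ _ _
  have hN' : (N : ℂ) ≠ 0 := by exact_mod_cast hN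
  rw [← Complex.ofReal_inj]
  simp only [dirichletSq]
  push_cast
  rw [← Finset.sum_div]
  have : ∑ k ∈ Finset.range N, (‖∑ n ∈ Finset.range N, ((z : ℂ) * (ρ : ℂ) ^ k) ^ n‖ : ℂ) ^ 2 =
      (N : ℂ) ^ 2 := by
    have h1 := fun k => hsq k
    push_cast at h1
    simp only [h1]
    rw [Finset.sum_comm]
    have h2 : ∀ n ∈ Finset.range N, ∑ k ∈ Finset.range N, ∑ m ∈ Finset.range N,
        ((z : ℂ) ^ n * ((z : ℂ) ^ m)⁻¹) * ((ρ : ℂ) ^ n * ((ρ : ℂ) ^ m)⁻¹) ^ k = N := by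
      intro n hn
      rw [Finset.sum_comm]
      simp only [← Finset.mul_sum]
      have h3 := horth n hn
      push_cast at h3
      rw [Finset.sum_congr rfl fun m hm => by rw [h3 m hm], Finset.sum_eq_single_of_mem n hn]
      · simp
      · intro m _ hmn
        simp [hmn.symm]
    rw [Finset.sum_congr rfl h2]
    simp
    ring
  rw [this, div_self (pow_ne_zero _ hN')]

theorem one_sub_dirichletSq_le {N : ℕ} (hN : N ≠ 0) (z : Circle) :
    1 - dirichletSq N z ≤ N ^ 2 * ‖(z : ℂ) - 1‖ ^ 2 := by
  have hN' : (0 : ℝ) < N := by exact_mod_cast Nat.pos_of_ne_zero hN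
  have hre : ∀ n ∈ Finset.range N, 2 * (1 - ((z : ℂ) ^ n).re) ≤ N ^ 2 * ‖(z : ℂ) - 1‖ ^ 2 := by
    intro n hn
    have h1 : 2 * (1 - ((z : ℂ) ^ n).re) = ‖(z : ℂ) ^ n - 1‖ ^ 2 := by
      have h := Complex.normSq_eq_norm_sq ((z : ℂ) ^ n)
      rw [norm_pow, Circle.norm_coe, one_pow, one_pow, Complex.normSq_apply] at h
      rw [← Complex.normSq_eq_norm_sq, Complex.normSq_apply, Complex.sub_re, Complex.sub_im,
        Complex.one_re, Complex.one_im]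
      nlinarith
    have h2 : ‖(z : ℂ) ^ n - 1‖ ≤ n * ‖(z : ℂ) - 1‖ := by
      rw [← geom_sum_mul, norm_mul]
      refine mul_le_mul_of_nonneg_right ((norm_sum_le _ _).trans (le_of_eq ?_)) (norm_nonneg _)
      simp [Circle.norm_coe]
    have h3 : (n : ℝ) ≤ N := by exact_mod_cast (Finset.mem_range.1 hn).le
    rw [h1, ← mul_pow]
    gcongr
    exact h2.trans (by gcongr)
  set s : ℂ := ∑ n ∈ Finset.range N, (z : ℂ) ^ n with hs
  have hsum : ∑ n ∈ Finset.range N, 2 * (1 - ((z : ℂ) ^ n).re) ≤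
      N * (N ^ 2 * ‖(z : ℂ) - 1‖ ^ 2) := by
    refine (Finset.sum_le_sum hre).trans (le_of_eq ?_)
    simp
  have hsum' : ∑ n ∈ Finset.range N, 2 * (1 - ((z : ℂ) ^ n).re) = 2 * (N - s.re) := by
    rw [← Finset.mul_sum, Finset.sum_sub_distrib, hs, Complex.re_sum]
    simp
  rw [hsum'] at hsum
  have h1 : s.re ^ 2 ≤ ‖s‖ ^ 2 := by
    rw [← Complex.normSq_eq_norm_sq, Complex.normSq_apply]
    nlinarith [sq_nonneg s.im]
  -- with `r = Re s / N`, use `1 - r² ≤ 2 (1 - r)`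
  have h2 : 1 - dirichletSq N z ≤ 2 * (N - s.re) / N := by
    rw [dirichletSq, ← hs, le_div_iff₀ hN', sub_mul, div_mul_eq_mul_div, one_mul]
    have : ‖s‖ ^ 2 * N / N ^ 2 = ‖s‖ ^ 2 / N := by field_simp
    rw [this, sub_le_iff_le_add, ← sub_le_iff_le_add', le_div_iff₀ hN']
    nlinarith [sq_nonneg ((N : ℝ) - s.re)]
  refine h2.trans ((div_le_iff₀ hN').2 (by linarith))

/-! ### Existence for an arbitrary matrix -/

/-- The Laurent polynomial `∏ⱼ Φ(|1 + z_j + ⋯ + z_j^{N-1}|² / N²)`, with `Φ` the step polynomial. -/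
def flatSymbol (N d : ℕ) : Laurent d :=
  let B : Fin d → Laurent d := fun j =>
    AddMonoidAlgebra.single 0 (((N : ℂ) ^ 2)⁻¹) *
      (invol (∑ n ∈ Finset.range N, zvar j ^ n) * ∑ n ∈ Finset.range N, zvar j ^ n)
  ∏ j, B j ^ 4 * (35 - 84 * B j + 70 * B j ^ 2 - 20 * B j ^ 3)

theorem eval_zvar {d : ℕ} (z : Torus d) (j : Fin d) : eval z (zvar j) = z j := by
  rw [zvar, eval_single, Finset.prod_eq_single j] <;> simp +contextual

theorem eval_flatSymbol (N : ℕ) {d : ℕ} (z : Torus d) :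
    eval z (flatSymbol N d) = ((∏ j, stepPoly (dirichletSq N (z j)) : ℝ) : ℂ) := by
  have hB : ∀ j, eval z (AddMonoidAlgebra.single 0 (((N : ℂ) ^ 2)⁻¹) *
      (invol (∑ n ∈ Finset.range N, zvar j ^ n) * ∑ n ∈ Finset.range N, zvar j ^ n)) =
      (dirichletSq N (z j) : ℂ) := by
    intro j
    rw [map_mul, eval_invol_mul_self, map_sum, eval_single, dirichletSq]
    simp only [map_pow, eval_zvar]
    simp
    ring
  rw [flatSymbol, map_prod]
  push_cast
  refine Finset.prod_congr rfl fun j _ => ?_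
  simp only [map_mul (eval z) (_ ^ 4), map_add, map_sub, map_pow _ (_ * _), map_mul (eval z) 84,
    map_mul (eval z) 70, map_mul (eval z) 20, map_ofNat, hB, stepPoly, stepCofactor]
  push_cast
  ring

theorem exists_isSubQMFWithoutUEP {M : Matrix (Fin 3) (Fin 3) ℤ} (hM : M.det ≠ 0) :
    ∃ p : Laurent 3, IsSubQMFWithoutUEP M p := by
  classical
  set N := M.det.natAbs with hNdef
  have hN : N ≠ 0 := Int.natAbs_ne_zero.2 hM
  have : NeZero N := ⟨hN⟩
  set ρ : Circle := Circle.exp (2 * Real.pi / N) with hρdef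
  have hρc : IsPrimitiveRoot (ρ : ℂ) N := by
    have := Complex.isPrimitiveRoot_exp N hN
    rw [hρdef, Circle.coe_exp]
    convert this using 2
    push_cast
    ring
  have hρ : IsPrimitiveRoot ρ N := by
    refine IsPrimitiveRoot.of_map_of_injective (f := Circle.coeHom) hρc ?_
    exact Subtype.val_injective
  set S : Finset Circle := (Finset.range N).image fun k => ρ ^ k with hSdef
  have hSsum : ∀ z, ∑ ζ ∈ S, dirichletSq N (z * ζ) = 1 := by
    intro z
    rw [hSdef, Finset.sum_image]
    · exact sum_dirichletSq_mul_pow hN hρ z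
    · intro i hi j hj hij
      exact hρ.pow_inj (by simpa using hi) (by simpa using hj) hij
  have h1S : (1 : Circle) ∈ S :=
    Finset.mem_image.2 ⟨0, Finset.mem_range.2 (Nat.pos_of_ne_zero hN), pow_zero _⟩
  have hle : ∀ z, dirichletSq N z ≤ 1 := fun z => by
    rw [← hSsum z]
    simpa using Finset.single_le_sum (f := fun ζ => dirichletSq N (z * ζ))
      (fun _ _ => dirichletSq_nonneg _ _) h1S
  have h1 : dirichletSq N 1 = 1 := by
    have : (N : ℝ) ≠ 0 := by exact_mod_cast hN
    simp [dirichletSq, this]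
  refine ⟨_, isSubQMFWithoutUEP_of_tensor (c := 1) (a := flatSymbol N 3)
    (b := fun z => stepPoly (dirichletSq N z) ^ 2) (S := S) (K := 70 * N ^ 8) one_pos le_rfl
    ?_ (fun z => sq_nonneg _) h1S (fun z => ?_) (fun z => ?_) (fun σ hσ j => ?_) fun z => ?_⟩
  · rw [eval_flatSymbol]
    norm_num [h1, stepPoly, stepCofactor]
  · refine le_trans (Finset.sum_le_sum fun ζ _ => ?_)
      (sum_stepPoly_le_one S (fun ζ => dirichletSq_nonneg N (z * ζ)) (hSsum z).le)
    have h0 := stepPoly_nonneg (hle (z * ζ))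
    have h1 := stepPoly_le_one (dirichletSq_nonneg N (z * ζ))
    nlinarith
  · have h0 := stepPoly_nonneg (hle z)
    have h1 := one_sub_stepPoly_le (dirichletSq_nonneg N z) (hle z)
    have h2 := pow_le_pow_left₀ (sub_nonneg.2 (hle z)) (one_sub_dirichletSq_le hN z) 4
    have h3 : ((N : ℝ) ^ 2 * ‖(z : ℂ) - 1‖ ^ 2) ^ 4 = N ^ 8 * ‖(z : ℂ) - 1‖ ^ 8 := by ring
    rw [h3] at h2
    nlinarith [sq_nonneg (1 - stepPoly (dirichletSq N z))]
  · have h := pow_natAbs_eq_one.2 (pow_det_eq_one M hM σ hσ j)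
    have h' : ((σ j : Circle) : ℂ) ^ N = 1 := by
      rw [← Circle.coe_pow, h, Circle.coe_one]
    obtain ⟨i, hi, hρi⟩ := hρc.eq_pow_of_pow_eq_one h'
    exact Finset.mem_image.2 ⟨i, Finset.mem_range.2 hi, Circle.ext (by simpa using hρi)⟩
  · rw [eval_flatSymbol, Complex.norm_real, Real.norm_eq_abs, sq_abs, Finset.prod_pow]

/-! ### Spectral factorization -/

open Polynomial

/-- The function `sin² (θ/2)` at the point `z = e^{iθ}`, written as `|1 - z|² / 4`. -/
def sinHalfSq (z : Circle) : ℝ := ‖1 - (z : ℂ)‖ ^ 2 / 4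

theorem sinHalfSq_eq (z : Circle) : sinHalfSq z = (1 - (z : ℂ).re) / 2 := by
  have h := Complex.normSq_eq_norm_sq (z : ℂ)
  rw [Circle.norm_coe, Complex.normSq_apply] at h
  rw [sinHalfSq, ← Complex.normSq_eq_norm_sq, Complex.normSq_apply, Complex.sub_re, Complex.sub_im,
    Complex.one_re, Complex.one_im]
  linarith

theorem sinHalfSq_mem_Icc (z : Circle) : sinHalfSq z ∈ Set.Icc (0 : ℝ) 1 := by
  have h := Complex.abs_re_le_norm (z : ℂ)
  rw [Circle.norm_coe, abs_le] at h
  rw [sinHalfSq_eq]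
  constructor <;> linarith [h.1, h.2]

theorem ofReal_sinHalfSq (z : Circle) :
    ((sinHalfSq z : ℝ) : ℂ) = (2 - (z : ℂ) - (z : ℂ)⁻¹) / 4 := by
  have h : (z : ℂ)⁻¹ = starRingEnd ℂ (z : ℂ) := by
    rw [← Circle.coe_inv, Circle.coe_inv_eq_conj]
  rw [sinHalfSq_eq, h]
  have := Complex.add_conj (z : ℂ)
  push_cast at this ⊢
  linear_combination (1 / 4) * this

/-- The substitution `y = (2 - z - z⁻¹) / 4` turns a linear factor `y - r` into a product of two
linear factors in `z` whose roots are mutually inverse, and reflecting one of them at the unit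
circle makes their roots conjugate. -/
theorem exists_norm_sinHalfSq_sub (r : ℂ) : ∃ w : ℂ, w ≠ 0 ∧
    w ^ 2 - 2 * (1 - 2 * r) * w + 1 = 0 ∧ ∀ z : Circle,
      ‖(sinHalfSq z : ℂ) - r‖ = ‖(z : ℂ) - w‖ * ‖(z : ℂ) - starRingEnd ℂ w‖ / (4 * ‖w‖) := by
  obtain ⟨s, hs⟩ := IsAlgClosed.exists_pow_nat_eq ((1 - 2 * r) ^ 2 - 1) (n := 2) (by norm_num)
  have hw : (1 - 2 * r + s) ^ 2 - 2 * (1 - 2 * r) * (1 - 2 * r + s) + 1 = 0 := by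
    linear_combination hs
  have hw0 : 1 - 2 * r + s ≠ 0 := by
    intro h
    rw [h] at hw
    norm_num at hw
  generalize 1 - 2 * r + s = w at hw hw0
  refine ⟨w, hw0, hw, fun z => ?_⟩
  have hz : (z : ℂ) ≠ 0 := Circle.coe_ne_zero z
  have h1 : (sinHalfSq z : ℂ) - r = ((z : ℂ) - w) * ((z : ℂ)⁻¹ - w) / (4 * w) := by
    rw [ofReal_sinHalfSq]
    field_simp
    linear_combination (-(z : ℂ)) * hw
  have h2 : ‖(z : ℂ)⁻¹ - w‖ = ‖(z : ℂ) - starRingEnd ℂ w‖ := by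
    rw [← Complex.norm_conj, map_sub, ← Circle.coe_inv, Circle.coe_inv_eq_conj, Complex.conj_conj]
  rw [h1, norm_div, norm_mul, norm_mul, h2]
  simp

/-- Spectral factorization of a real linear factor without a root in `[0, 1]`. -/
theorem exists_norm_sq_eq_linear {r : ℝ} (hr : r ∉ Set.Icc (0 : ℝ) 1) :
    ∃ Q : ℝ[X], Q.natDegree ≤ 1 ∧
      ∀ z : Circle, ‖aeval (z : ℂ) Q‖ ^ 2 = |sinHalfSq z - r| := by
  obtain ⟨w, hw0, hw, hz⟩ := exists_norm_sinHalfSq_sub (r : ℂ)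
  -- the discriminant of the equation for `w` is nonnegative, so that `w` is real
  have him : w.im = 0 := by
    have hre := congrArg Complex.re hw
    have him := congrArg Complex.im hw
    simp [pow_two] at hre him
    by_contra h
    have h1 : w.re = 1 - 2 * r := by
      have : w.im * (w.re - (1 - 2 * r)) = 0 := by linarith
      rcases mul_eq_zero.1 this with h' | h'
      · exact absurd h' h
      · linarith
    have h2 : 0 < w.im ^ 2 := by positivity
    apply hr
    rw [h1] at hre
    constructor <;> nlinarith
  have hwr : w = (w.re : ℂ) := Complex.ext (by simp) (by simp [him])
  have hw1 : 0 < ‖w‖ := norm_pos_iff.2 hw0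
  refine ⟨C (√(4 * ‖w‖))⁻¹ * (X - C w.re), ?_, fun z => ?_⟩
  · exact (natDegree_C_mul_le _ _).trans (natDegree_X_sub_C_le _)
  · have hz' := hz z
    rw [← Complex.ofReal_sub, Complex.norm_real, Real.norm_eq_abs] at hz'
    have hconj : starRingEnd ℂ w = w := Complex.conj_eq_iff_im.2 him
    rw [hz', hconj, map_mul, map_sub, aeval_X, aeval_C, aeval_C, norm_mul, mul_pow]
    have e1 : (algebraMap ℝ ℂ) w.re = w := hwr.symm
    have e2 : ‖(algebraMap ℝ ℂ) (√(4 * ‖w‖))⁻¹‖ ^ 2 = (4 * ‖w‖)⁻¹ := by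
      rw [norm_algebraMap', Real.norm_eq_abs, sq_abs, inv_pow, Real.sq_sqrt (by positivity)]
    rw [e1, e2]
    field_simp

/-- Spectral factorization of a real quadratic factor without real roots. -/
theorem exists_norm_sq_eq_quadratic (r : ℂ) :
    ∃ Q : ℝ[X], Q.natDegree ≤ 2 ∧ ∀ z : Circle,
      ‖aeval (z : ℂ) Q‖ ^ 2 = |(X ^ 2 - C (2 * r.re) * X + C (‖r‖ ^ 2)).eval (sinHalfSq z)| := by
  obtain ⟨w, hw0, -, hz⟩ := exists_norm_sinHalfSq_sub r
  refine ⟨C (4 * ‖w‖)⁻¹ * (X ^ 2 - C (2 * w.re) * X + C (‖w‖ ^ 2)), ?_, fun z => ?_⟩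
  · refine (natDegree_C_mul_le _ _).trans ?_
    compute_degree
  · have e1 : (X ^ 2 - C (2 * r.re) * X + C (‖r‖ ^ 2)).eval (sinHalfSq z) =
        ‖(sinHalfSq z : ℂ) - r‖ ^ 2 := by
      rw [← Complex.normSq_eq_norm_sq, ← Complex.normSq_eq_norm_sq, Complex.normSq_apply,
        Complex.normSq_apply]
      simp
      ring
    have e2 : aeval (z : ℂ) (X ^ 2 - C (2 * w.re) * X + C (‖w‖ ^ 2)) =
        ((z : ℂ) - w) * ((z : ℂ) - starRingEnd ℂ w) := by
      have h1 := Complex.add_conj w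
      have h2 := Complex.mul_conj' w
      push_cast at h1
      simp
      linear_combination (z : ℂ) * h1 - h2
    rw [e1, abs_of_nonneg (by positivity), hz, map_mul, e2, norm_mul, norm_mul, aeval_C,
      norm_algebraMap', Real.norm_of_nonneg (by positivity)]
    congr 1
    ring

/-- **Fejér–Riesz factorization** with real coefficients: a real polynomial in `sin² (θ/2)` without
zeros on `[0, 1]` is, up to its sign, the squared modulus of a real polynomial in `e^{iθ}` of no
larger degree. -/
theorem exists_norm_sq_eq_abs_eval (P : ℝ[X]) (hP : ∀ y ∈ Set.Icc (0 : ℝ) 1, P.eval y ≠ 0) :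
    ∃ Q : ℝ[X], Q.natDegree ≤ P.natDegree ∧
      ∀ z : Circle, ‖aeval (z : ℂ) Q‖ ^ 2 = |P.eval (sinHalfSq z)| := by
  induction hn : P.natDegree using Nat.strong_induction_on generalizing P with
  | _ n ih =>
  have hP0 : P ≠ 0 := by
    rintro rfl
    exact hP 0 (by simp) (by simp)
  rcases Nat.eq_zero_or_pos n with rfl | hpos
  · obtain ⟨c, rfl⟩ := natDegree_eq_zero.1 hn
    refine ⟨C √|c|, by simp, fun z => ?_⟩
    rw [aeval_C, norm_algebraMap', Real.norm_eq_abs, sq_abs, Real.sq_sqrt (abs_nonneg c), eval_C]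
  -- a factor with a spectral factorization may be split off
  have step : ∀ (F P' F' : ℝ[X]), P = F * P' → 0 < F.natDegree → F'.natDegree ≤ F.natDegree →
      (∀ z : Circle, ‖aeval (z : ℂ) F'‖ ^ 2 = |F.eval (sinHalfSq z)|) →
      ∃ Q : ℝ[X], Q.natDegree ≤ n ∧
        ∀ z : Circle, ‖aeval (z : ℂ) Q‖ ^ 2 = |P.eval (sinHalfSq z)| := by
    rintro F P' F' rfl hF hF' hFz
    have hdeg := natDegree_mul (left_ne_zero_of_mul hP0) (right_ne_zero_of_mul hP0)
    obtain ⟨Q, hQ, hQz⟩ := ih P'.natDegree (by omega) P'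
      (fun y hy h => hP y hy (by rw [eval_mul, h, mul_zero])) rfl
    refine ⟨F' * Q, natDegree_mul_le.trans (by omega), fun z => ?_⟩
    rw [map_mul, norm_mul, mul_pow, hFz, hQz, eval_mul, abs_mul]
  obtain ⟨r, hr⟩ : ∃ r : ℂ, aeval r P = 0 := by
    refine IsAlgClosed.exists_aeval_eq_zero ℂ P ?_
    exact (natDegree_pos_iff_degree_pos.1 (hn ▸ hpos)).ne'
  by_cases him : r.im = 0
  · have hrr : r = (r.re : ℂ) := Complex.ext (by simp) (by simp [him])
    have hroot : P.eval r.re = 0 := by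
      rw [hrr] at hr
      have : (algebraMap ℝ ℂ) (P.eval r.re) = 0 := by
        rw [← aeval_algebraMap_apply_eq_algebraMap_eval]
        exact hr
      simpa using this
    obtain ⟨P', hP'⟩ := dvd_iff_isRoot.2 hroot
    obtain ⟨F', hF', hF'z⟩ := exists_norm_sq_eq_linear (r := r.re) fun h => hP _ h hroot
    exact step _ P' F' hP' (by simp) (by simpa using hF') (by simpa using hF'z)
  · obtain ⟨P', hP'⟩ := P.quadratic_dvd_of_aeval_eq_zero_im_ne_zero hr him
    obtain ⟨F', hF', hF'z⟩ := exists_norm_sq_eq_quadratic r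
    have hdeg : (X ^ 2 - C (2 * r.re) * X + C (‖r‖ ^ 2) : ℝ[X]).natDegree = 2 := by
      compute_degree!
    exact step _ P' F' hP' (by omega) (by omega) hF'z

/-! ### Daubechies symbols -/

/-- The polynomial `∑_{k < 8} (7 + k choose k) y^k`. -/
def daubechiesPoly : ℝ[X] :=
  3432 * X ^ 7 + 1716 * X ^ 6 + 792 * X ^ 5 + 330 * X ^ 4 + 120 * X ^ 3 + 36 * X ^ 2 + 8 * X + 1

theorem eval_daubechiesPoly (y : ℝ) : daubechiesPoly.eval y = 3432 * y ^ 7 + 1716 * y ^ 6 +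
    792 * y ^ 5 + 330 * y ^ 4 + 120 * y ^ 3 + 36 * y ^ 2 + 8 * y + 1 := by
  simp [daubechiesPoly]

/-- The Bézout identity `(1 - y)⁸ P(y) + y⁸ P(1 - y) = 1`. -/
theorem daubechiesPoly_bezout (y : ℝ) :
    (1 - y) ^ 8 * daubechiesPoly.eval y + y ^ 8 * daubechiesPoly.eval (1 - y) = 1 := by
  rw [eval_daubechiesPoly, eval_daubechiesPoly]
  ring

theorem sinHalfSq_neg (z : Circle) : sinHalfSq (-z) = 1 - sinHalfSq z := by
  rw [sinHalfSq_eq, sinHalfSq_eq, Circle.coe_neg, Complex.neg_re]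
  ring

theorem exists_isDaubechiesSymbol : ∃ u : ℝ[X], IsDaubechiesSymbol 8 u := by
  have hpos : ∀ y ∈ Set.Icc (0 : ℝ) 1, 0 < daubechiesPoly.eval y := by
    intro y hy
    have := hy.1
    rw [eval_daubechiesPoly]
    positivity
  obtain ⟨Q, hQ, hQz⟩ := exists_norm_sq_eq_abs_eval daubechiesPoly fun y hy => (hpos y hy).ne'
  have hQdeg : Q.natDegree ≤ 7 := hQ.trans (by rw [daubechiesPoly]; compute_degree)
  have hQ1 : Q.eval 1 ^ 2 = 1 := by
    have h := hQz 1
    have h1 : aeval (1 : ℂ) Q = ((Q.eval 1 : ℝ) : ℂ) := by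
      simpa using aeval_algebraMap_apply_eq_algebraMap_eval (A := ℂ) (1 : ℝ) Q
    rw [Circle.coe_one, h1, Complex.norm_real, Real.norm_eq_abs, sq_abs] at h
    rw [h, eval_daubechiesPoly]
    simp [sinHalfSq]
  -- multiplication by `Q(1) = ±1` normalises the value at `1`
  refine ⟨C (Q.eval 1 / 2 ^ 8) * ((1 + X) ^ 8 * Q), ?_, ?_, ?_, fun z => ?_⟩
  · refine Nat.lt_of_le_of_lt ((natDegree_C_mul_le _ _).trans natDegree_mul_le) ?_
    have : ((1 + X : ℝ[X]) ^ 8).natDegree ≤ 8 := by compute_degree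
    omega
  · exact Dvd.intro_left (C (Q.eval 1 / 2 ^ 8) * Q) (by ring)
  · rw [eval_mul, eval_mul, eval_C, eval_pow, eval_add, eval_one, eval_X]
    linear_combination hQ1
  · have hsq : ∀ z : Circle, ‖aeval (z : ℂ) (C (Q.eval 1 / 2 ^ 8) * ((1 + X) ^ 8 * Q))‖ ^ 2 =
        (1 - sinHalfSq z) ^ 8 * daubechiesPoly.eval (sinHalfSq z) := by
      intro z
      have h1 : 1 - sinHalfSq z = ‖1 + (z : ℂ)‖ ^ 2 / 4 := by
        rw [← sinHalfSq_neg, sinHalfSq, Circle.coe_neg, sub_neg_eq_add]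
      have h2 := hQz z
      rw [abs_of_pos (hpos _ (sinHalfSq_mem_Icc z))] at h2
      rw [h1, ← h2, map_mul, map_mul, map_pow, map_add, map_one, aeval_X, aeval_C, norm_mul,
        norm_mul, norm_pow, norm_algebraMap', Real.norm_eq_abs, mul_pow, sq_abs, div_pow, hQ1]
      ring
    have := hsq (-z)
    rw [Circle.coe_neg, sinHalfSq_neg, sub_sub_cancel] at this
    rw [hsq z, this]
    exact daubechiesPoly_bezout _

theorem eval_tensorSymbol {d : ℕ} (u : ℝ[X]) (z : Torus d) :
    eval z (tensorSymbol d u) = ∏ j, aeval (z j : ℂ) u := by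
  rw [tensorSymbol, map_prod]
  refine Finset.prod_congr rfl fun j _ => ?_
  have h := aeval_algHom_apply ((eval z).restrictScalars ℝ) (zvar j) u
  rw [AlgHom.restrictScalars_apply, eval_zvar] at h
  exact h.symm

theorem eq_one_or_eq_neg_one_of_mem_dilationGroup_two {d : ℕ} {σ : Torus d}
    (hσ : σ ∈ dilationGroup (2 : Matrix (Fin d) (Fin d) ℤ)) (j : Fin d) : σ j = 1 ∨ σ j = -1 := by
  obtain ⟨k, rfl⟩ := hσ
  have hinv : ((2 : Matrix (Fin d) (Fin d) ℤ).map (Int.cast : ℤ → ℝ)).transpose⁻¹ =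
      (2⁻¹ : ℝ) • (1 : Matrix (Fin d) (Fin d) ℝ) := by
    refine Matrix.inv_eq_left_inv ?_
    have : (2 : Matrix (Fin d) (Fin d) ℤ).map (Int.cast : ℤ → ℝ) =
        (2 : ℝ) • (1 : Matrix (Fin d) (Fin d) ℝ) := by
      rw [two_smul, one_add_one_eq_two]
      exact map_ofNat (Int.castRingHom ℝ).mapMatrix 2
    rw [this]
    simp
  have h2 : expTorus ((2 * Real.pi) • ((2⁻¹ : ℝ) • (1 : Matrix (Fin d) (Fin d) ℝ)).mulVec
      fun j => (k j : ℝ)) j = Circle.exp (-(k j * Real.pi)) := by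
    rw [expTorus, Matrix.smul_mulVec, Matrix.one_mulVec]
    congr 1
    simp
    ring
  rw [hinv, h2]
  have h3 : ((Circle.exp (-(k j * Real.pi)) : Circle) : ℂ) *
      ((Circle.exp (-(k j * Real.pi)) : Circle) : ℂ) = 1 := by
    rw [← pow_two, ← Circle.coe_pow, ← Circle.exp_nsmul]
    have : Circle.exp (2 • (-(k j * Real.pi))) = 1 := by
      rw [Circle.exp_eq_one]
      refine ⟨-k j, ?_⟩
      push_cast
      simp
      ring
    rw [this, Circle.coe_one]
  rcases mul_self_eq_one_iff.1 h3 with h | h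
  · exact Or.inl (Circle.ext h)
  · exact Or.inr (Circle.ext h)

/-- The factor `(1 + z)⁸` makes `|u(-z)|² = 1 - |u(z)|²` small near `z = 1`. -/
theorem IsDaubechiesSymbol.exists_one_sub_norm_sq_le {u : ℝ[X]} (hu : IsDaubechiesSymbol 8 u) :
    ∃ K : ℝ, ∀ z : Circle, 1 - ‖aeval (z : ℂ) u‖ ^ 2 ≤ K * ‖(z : ℂ) - 1‖ ^ 8 := by
  obtain ⟨v, hv⟩ := hu.dvd
  have hcont : Continuous fun z : ℂ => ‖aeval z v‖ := by fun_prop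
  obtain ⟨B, hB⟩ := (isCompact_sphere (0 : ℂ) 1).bddAbove_image hcont.continuousOn
  have hBz : ∀ z : Circle, ‖aeval (-(z : ℂ)) v‖ ≤ B := fun z =>
    hB ⟨-(z : ℂ), by simp [Circle.norm_coe], rfl⟩
  refine ⟨2 ^ 8 * B ^ 2, fun z => ?_⟩
  have h1 : aeval (-(z : ℂ)) u = (1 - (z : ℂ)) ^ 8 * aeval (-(z : ℂ)) v := by
    conv_lhs => rw [hv]
    simp [sub_eq_add_neg]
  have h2 : ‖(z : ℂ) - 1‖ ≤ 2 := by
    refine (norm_sub_le _ _).trans ?_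
    rw [Circle.norm_coe, norm_one]
    norm_num
  have h3 : 1 - ‖aeval (z : ℂ) u‖ ^ 2 = ‖aeval (-(z : ℂ)) u‖ ^ 2 := by
    linarith [hu.qmf z]
  rw [h3, h1, norm_mul, norm_pow, norm_sub_rev]
  calc (‖(z : ℂ) - 1‖ ^ 8 * ‖aeval (-(z : ℂ)) v‖) ^ 2
      = ‖(z : ℂ) - 1‖ ^ 8 * ‖aeval (-(z : ℂ)) v‖ ^ 2 * ‖(z : ℂ) - 1‖ ^ 8 := by ring
    _ ≤ 2 ^ 8 * B ^ 2 * ‖(z : ℂ) - 1‖ ^ 8 := by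
      gcongr
      exact hBz z

theorem IsDaubechiesSymbol.isSubQMFWithoutUEP {u : ℝ[X]} (hu : IsDaubechiesSymbol 8 u) {c : ℝ}
    (hc0 : 0 < c) (hc : c ≤ 1) :
    IsSubQMFWithoutUEP (2 : Matrix (Fin 3) (Fin 3) ℤ) (motzkinSymbol c (tensorSymbol 3 u)) := by
  classical
  obtain ⟨K, hK⟩ := hu.exists_one_sub_norm_sq_le
  refine isSubQMFWithoutUEP_of_tensor (b := fun z => ‖aeval (z : ℂ) u‖ ^ 2) (S := {1, -1}) hc0 hc
    ?_ (fun z => by positivity) (by simp) (fun z => ?_) hK (fun σ hσ j => ?_) fun z => ?_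
  · rw [eval_tensorSymbol]
    have h1 : aeval (1 : ℂ) u = ((u.eval 1 : ℝ) : ℂ) := by
      simpa using aeval_algebraMap_apply_eq_algebraMap_eval (A := ℂ) (1 : ℝ) u
    simp [h1, hu.eval_one]
  · have hne : (1 : Circle) ≠ -1 := by
      intro h
      have := congrArg (fun w : Circle => (w : ℂ)) h
      norm_num [Complex.ext_iff] at this
    rw [Finset.sum_pair hne]
    have := hu.qmf z
    simpa using this.le
  · simpa using eq_one_or_eq_neg_one_of_mem_dilationGroup_two hσ j
  · rw [eval_tensorSymbol, norm_prod, Finset.prod_pow]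

end TightFrame

end

theorem mainTheorem2 :
    (∀ M : Matrix (Fin 3) (Fin 3) ℤ, M.det ≠ 0 →
      (∃ p : TightFrame.Laurent 3, TightFrame.IsSubQMFWithoutUEP M p) ∧
      ∀ (c : ℝ) (a : TightFrame.Laurent 3), 0 < c → c ≤ 1 / 3 →
        TightFrame.eval 1 a = 1 → TightFrame.SubQMF M a →
        (∀ k : ℕ, 0 < k → k < 8 →
          iteratedFDeriv ℝ k (TightFrame.trigFun (TightFrame.invol a * a)) 0 = 0) →
        TightFrame.IsSubQMFWithoutUEP M (TightFrame.motzkinSymbol c a)) ∧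
    (∃ u : Polynomial ℝ, TightFrame.IsDaubechiesSymbol 8 u) ∧
    (∀ (u : Polynomial ℝ) (c : ℝ), TightFrame.IsDaubechiesSymbol 8 u → 0 < c → c ≤ 1 / 3 →
      TightFrame.IsSubQMFWithoutUEP (2 : Matrix (Fin 3) (Fin 3) ℤ)
        (TightFrame.motzkinSymbol c (TightFrame.tensorSymbol 3 u))) := by
  refine ⟨fun M hM => ⟨TightFrame.exists_isSubQMFWithoutUEP hM, fun c a hc0 hc ha hsub h => ?_⟩,
    TightFrame.exists_isDaubechiesSymbol,
    fun u c hu hc0 hc => hu.isSubQMFWithoutUEP hc0 (by linarith)⟩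
  exact TightFrame.isSubQMFWithoutUEP_motzkinSymbol hc0 (by linarith) ha hsub
    (TightFrame.isLittleO_one_sub_norm_sq ha h)
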